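/- Let $A$ be a commutative ring and let $\mathcal C$ be an $A$-linear abelian category (i.e. an abelian category in which every $\mathrm{Hom}(X,Y)$ is an $A$-module and composition is $A$-bilinear) which has small filtered colimits and in which small filtered colimits are exact. For a commutative $A$-algebra $B$, let $\mathcal C_B$ be the category of objects $X$ of $\mathcal C$ equipped with a homomorphism of $A$-algebras $B\to\mathrm{End}(X)$, with morphisms the morphisms of $\mathcal C$ that commute with the $B$-actions (the base change $\mathcal C\times_{\mathrm{Spec} A}\mathrm{Spec} B$). For a $B$-module $M$ with presentation $B^{(I)}\to B^{(J)}\to M\to 0$ and $X\in\mathcal C_B$, put $M\otimes_B X=\mathrm{coker}(X^{(I)}\to X^{(J)})$, where the matrix entries act through $B\to\mathrm{End}(X)$. For a homomorphism $g:B\to B'$ of $A$-algebras let $g^*:\mathcal C_B\to\mathcal C_{B'}$, $g^*X=B'\otimes_B X$, with $B'$ acting by multiplication on the left factor; there are canonical isomorphisms $(h\circ g)^*\cong h^*g^*$. Let $A'$ be a commutative $A$-algebra, $A''=A'\otimes_A A'$ and $A'''=A'\otimes_A A'\otimes_A A'$. Write $p_1,p_2:A'\to A''$ and $q_{12},q_{23},q_{13}:A''\to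 A'''$ for the homomorphisms that correspond to the projections, i.e. $p_1(a)=a\otimes 1$, $p_2(a)=1\otimes a$, $q_{12}(a\otimes b)=a\otimes b\otimes 1$, $q_{23}(a\otimes b)=1\otimes a\otimes b$ and $q_{13}(a\otimes b)=a\otimes 1\otimes b$. A descent datum on $\mathcal C'=\mathcal C_{A'}$ relative to $S''=\mathrm{Spec} A''$ is an object $X'$ of $\mathcal C'$ together with an isomorphism $\varphi:p_1^*X'\to p_2^*X'$ in $\mathcal C_{A''}$ such that $q_{23}^*\varphi\circ q_{12}^*\varphi=q_{13}^*\varphi$ in $\mathcal C_{A'''}$, modulo the canonical isomorphisms; a morphism $(X',\varphi)\to(Y',\psi)$ is a morphism $u:X'\to Y'$ of $\mathcal C'$ with $p_2^*u\circ\varphi=\psi\circ p_1^*u$. If $A'$ is faithfully flat over $A$, then the natural functor from $\mathcal C$ to the category of descent data on $\mathcal C'$ relative to $S''$, which sends $X$ to $A'\otimes_A X$ with the canonical isomorphism $p_1^*(A'\otimes_A X)\cong A''\otimes_A X\cong p_2^*(A'\otimes_A X)$, is an equivalence of categories. -/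

import Mathlib

open CategoryTheory CategoryTheory.Limits
open scoped TensorProduct

universe w v u

namespace LinearDescent

/-! ### Base change of an `A`-linear category -/

/-- Objects of the base change `C ×_{Spec A} Spec B` of an `A`-linear category `C` along `A → B`:
objects of `C` with an action of `B` for which the two actions of `A` coincide. -/
structure BaseChange (A B : Type w) [CommRing A] [CommRing B] [Algebra A B]
    (C : Type u) [Category.{v} C] [Preadditive C] [Linear A C] where
  /-- the underlying object -/
  obj : C
  /-- the action of `B`; being a homomorphism of `A`-algebras, it sends the image of `a : A`
  to the endomorphism `a • 𝟙` given by the `A`-linear structure of `C` -/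
  act : B →ₐ[A] End obj

section BaseChange

variable {A B : Type w} [CommRing A] [CommRing B] [Algebra A B]
  {C : Type u} [Category.{v} C] [Preadditive C] [Linear A C]

namespace BaseChange

/-- The action of `b` as a morphism of `C`. -/
def actHom (X : BaseChange A B C) (b : B) : X.obj ⟶ X.obj := X.act b

lemma actHom_zero (X : BaseChange A B C) : X.actHom 0 = 0 := map_zero X.act

lemma actHom_one (X : BaseChange A B C) : X.actHom 1 = 𝟙 _ := map_one X.act

lemma actHom_add (X : BaseChange A B C) (b b' : B) :
    X.actHom (b + b') = X.actHom b + X.actHom b' := map_add X.act b b'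

lemma actHom_mul (X : BaseChange A B C) (b b' : B) :
    X.actHom (b * b') = X.actHom b' ≫ X.actHom b := map_mul X.act b b'

lemma actHom_algebraMap (X : BaseChange A B C) (a : A) :
    X.actHom (algebraMap A B a) = a • 𝟙 X.obj :=
  (X.act.commutes a).trans (Algebra.algebraMap_eq_smul_one a)

/-- Morphisms of the base change: morphisms of `C` which commute with the action of `B`. -/
@[ext]
structure Hom (X Y : BaseChange A B C) where
  /-- the underlying morphism -/
  hom : X.obj ⟶ Y.obj
  comm : ∀ b : B, X.actHom b ≫ hom = hom ≫ Y.actHom b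

instance : Category (BaseChange A B C) where
  Hom X Y := Hom X Y
  id X := ⟨𝟙 X.obj, fun b => by simp⟩
  comp f g := ⟨f.hom ≫ g.hom, fun b => by
    rw [← Category.assoc, f.comm, Category.assoc, g.comm, Category.assoc]⟩

@[ext]
lemma hom_ext {X Y : BaseChange A B C} {f g : X ⟶ Y} (h : f.hom = g.hom) : f = g :=
  Hom.ext h

@[simp] lemma id_hom (X : BaseChange A B C) : (𝟙 X : X ⟶ X).hom = 𝟙 X.obj := rfl

@[simp] lemma comp_hom {X Y Z : BaseChange A B C} (f : X ⟶ Y) (g : Y ⟶ Z) :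
    (f ≫ g).hom = f.hom ≫ g.hom := rfl

variable (A C) in
/-- An object of `C`, seen as an object of the base change along the identity of `A`:
`A` acts through the `A`-linear structure. -/
def ofBase : C ⥤ BaseChange A A C where
  obj X := ⟨X, Algebra.ofId A (End X)⟩
  map f := ⟨f, fun a => by
    have h (Z : C) : (⟨Z, Algebra.ofId A (End Z)⟩ : BaseChange A A C).actHom a = a • 𝟙 Z :=
      actHom_algebraMap (⟨Z, Algebra.ofId A (End Z)⟩ : BaseChange A A C) a
    rw [h, h, Linear.smul_comp, Linear.comp_smul, Category.id_comp, Category.comp_id]⟩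

end BaseChange

end BaseChange

/-! ### Tensor product of a module with an object -/

section Tensor

/-- Filtered colimits and finite coproducts give all coproducts. -/
instance hasCoproductsOfShape (C : Type u) [Category.{v} C] [Abelian C]
    [HasFilteredColimitsOfSize.{w, w} C] (J : Type w) : HasColimitsOfShape (Discrete J) C :=
  hasCoproducts_of_finite_and_filtered.{w} J

variable {A B : Type w} [CommRing A] [CommRing B] [Algebra A B]
  {C : Type u} [Category.{v} C] [Abelian C] [Linear A C] [HasFilteredColimitsOfSize.{w, w} C]

/-- The relations of the tautological presentation of the `B`-module `M`, i.e. the kernel of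
the surjection `B^(M) → M` which sends the basis vector at `m` to `m`. -/
abbrev Relations (B M : Type w) [CommRing B] [AddCommGroup M] [Module B M] : Type w :=
  LinearMap.ker (Finsupp.linearCombination B (id : M → M))

/-- The morphism `X → X^(M)` given by a vector `k ∈ B^(M)`: its component at `m` is the action
of `k m` on `X`. -/
noncomputable def relationHom (X : BaseChange A B C) {M : Type w} (k : M →₀ B) :
    X.obj ⟶ ∐ fun _ : M => X.obj :=
  k.sum fun m b => X.actHom b ≫ Sigma.ι (fun _ : M => X.obj) m

lemma relationHom_add (X : BaseChange A B C) {M : Type w} (k l : M →₀ B) :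
    relationHom X (k + l) = relationHom X k + relationHom X l :=
  Finsupp.sum_add_index' (fun m => by rw [X.actHom_zero, zero_comp])
    (fun m b b' => by rw [X.actHom_add, Preadditive.add_comp])

lemma relationHom_single (X : BaseChange A B C) {M : Type w} (m : M) (b : B) :
    relationHom X (Finsupp.single m b) = X.actHom b ≫ Sigma.ι (fun _ : M => X.obj) m :=
  Finsupp.sum_single_index (by rw [X.actHom_zero, zero_comp])

lemma relationHom_sub (X : BaseChange A B C) {M : Type w} (k l : M →₀ B) :
    relationHom X (k - l) = relationHom X k - relationHom X l := by
  rw [eq_sub_iff_add_eq, ← relationHom_add, sub_add_cancel]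

/-- The tensor product `M ⊗_B X` of a `B`-module `M` and an object `X` with an action of `B`,
as the cokernel of the matrix `X^(K) → X^(M)` attached to the presentation
`B^(K) → B^(M) → M → 0`, where `K` is the set of all relations. -/
noncomputable def tensor (M : Type w) [AddCommGroup M] [Module B M] (X : BaseChange A B C) : C :=
  cokernel (Sigma.desc fun k : Relations B M => relationHom X k.1)

variable {M : Type w} [AddCommGroup M] [Module B M]

/-- The morphism `X → M ⊗_B X`, `x ↦ m ⊗ x`. -/
noncomputable def tensorι (X : BaseChange A B C) (m : M) : X.obj ⟶ tensor M X :=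
  Sigma.ι (fun _ : M => X.obj) m ≫ cokernel.π _

lemma relationHom_π (X : BaseChange A B C) (k : M →₀ B)
    (hk : Finsupp.linearCombination B (id : M → M) k = 0) :
    relationHom X k ≫ cokernel.π (Sigma.desc fun k : Relations B M => relationHom X k.1) = 0 := by
  have h := cokernel.condition (Sigma.desc fun k : Relations B M => relationHom X k.1)
  rw [← Sigma.ι_desc (fun k : Relations B M => relationHom X k.1) ⟨k, hk⟩, Category.assoc, h,
    comp_zero]

lemma tensorι_add (X : BaseChange A B C) (m n : M) :
    tensorι X (m + n) = tensorι X m + tensorι X n := by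
  have h := relationHom_π X
    (Finsupp.single (m + n) (1 : B) - (Finsupp.single m 1 + Finsupp.single n 1)) (by simp)
  rw [relationHom_sub, relationHom_add, relationHom_single, relationHom_single,
    relationHom_single, X.actHom_one, Category.id_comp, Category.id_comp, Category.id_comp,
    Preadditive.sub_comp, Preadditive.add_comp, sub_eq_zero] at h
  exact h

lemma tensorι_smul (X : BaseChange A B C) (b : B) (m : M) :
    tensorι X (b • m) = X.actHom b ≫ tensorι X m := by
  have h := relationHom_π X
    (Finsupp.single (b • m) (1 : B) - Finsupp.single m b) (by simp)
  rw [relationHom_sub, relationHom_single, relationHom_single, X.actHom_one, Category.id_comp,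
    Preadditive.sub_comp, sub_eq_zero] at h
  exact h.trans (Category.assoc _ _ _)

lemma tensor_hom_ext (X : BaseChange A B C) {Y : C} {f g : tensor M X ⟶ Y}
    (h : ∀ m : M, tensorι X m ≫ f = tensorι X m ≫ g) : f = g := by
  refine (cancel_epi (cokernel.π _)).1 (Sigma.hom_ext _ _ fun m => ?_)
  exact (Category.assoc _ _ _).symm.trans ((h m).trans (Category.assoc _ _ _))

lemma sum_relation_eq_zero (X : BaseChange A B C) {Y : C} (t : M → (X.obj ⟶ Y))
    (hadd : ∀ m n, t (m + n) = t m + t n) (hsmul : ∀ (b : B) m, t (b • m) = X.actHom b ≫ t m)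
    (k : M →₀ B) : relationHom X k ≫ Sigma.desc t =
      t (Finsupp.linearCombination B (id : M → M) k) := by
  induction k using Finsupp.induction_linear with
  | zero =>
    have h0 : t 0 = 0 := by simpa using hadd 0 0
    simp [relationHom, h0]
  | add k l hk hl => rw [relationHom_add, Preadditive.add_comp, hk, hl, map_add, hadd]
  | single m b => simp [relationHom_single, hsmul]

/-- Universal property of `M ⊗_B X`: morphisms to `Y` are `B`-bilinear families of
morphisms `X → Y` indexed by `M`. -/
noncomputable def tensorDesc (X : BaseChange A B C) {Y : C} (t : M → (X.obj ⟶ Y))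
    (hadd : ∀ m n, t (m + n) = t m + t n)
    (hsmul : ∀ (b : B) m, t (b • m) = X.actHom b ≫ t m) : tensor M X ⟶ Y :=
  cokernel.desc _ (Sigma.desc t) (Sigma.hom_ext _ _ fun k => by
    have h0 : t 0 = 0 := by simpa using hadd 0 0
    rw [← Category.assoc, Sigma.ι_desc, comp_zero, sum_relation_eq_zero X t hadd hsmul,
      LinearMap.mem_ker.1 k.2, h0])

@[simp]
lemma tensorι_desc (X : BaseChange A B C) {Y : C} (t : M → (X.obj ⟶ Y))
    (hadd : ∀ m n, t (m + n) = t m + t n)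
    (hsmul : ∀ (b : B) m, t (b • m) = X.actHom b ≫ t m) (m : M) :
    tensorι X m ≫ tensorDesc X t hadd hsmul = t m :=
  (Category.assoc _ _ _).trans
    ((congrArg (_ ≫ ·) (cokernel.π_desc _ _ _)).trans (Sigma.ι_desc _ _))

end Tensor

/-! ### Extension of scalars -/

section Extend

variable {A B B' B'' : Type w} [CommRing A] [CommRing B] [Algebra A B] [CommRing B'] [Algebra A B']
  [CommRing B''] [Algebra A B'']
  {C : Type u} [Category.{v} C] [Abelian C] [Linear A C] [HasFilteredColimitsOfSize.{w, w} C]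

/-- The underlying object `B' ⊗_B X` of the pullback of `X` along `g : B → B'`, where `B'` is a
`B`-module through `g`. -/
noncomputable def extendTensor (g : B →ₐ[A] B') (X : BaseChange A B C) : C :=
  letI : Module B B' := Module.compHom B' g.toRingHom
  tensor B' X

/-- The morphism `X → B' ⊗_B X`, `x ↦ b' ⊗ x`. -/
noncomputable def extendι (g : B →ₐ[A] B') (X : BaseChange A B C) (b' : B') :
    X.obj ⟶ extendTensor g X :=
  letI : Module B B' := Module.compHom B' g.toRingHom
  tensorι X b'

lemma extendι_add (g : B →ₐ[A] B') (X : BaseChange A B C) (m n : B') :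
    extendι g X (m + n) = extendι g X m + extendι g X n :=
  letI : Module B B' := Module.compHom B' g.toRingHom
  tensorι_add X m n

lemma extendι_mul (g : B →ₐ[A] B') (X : BaseChange A B C) (b : B) (m : B') :
    extendι g X (g b * m) = X.actHom b ≫ extendι g X m :=
  letI : Module B B' := Module.compHom B' g.toRingHom
  tensorι_smul X b m

lemma extendTensor_hom_ext (g : B →ₐ[A] B') (X : BaseChange A B C) {Y : C}
    {f f' : extendTensor g X ⟶ Y} (h : ∀ m : B', extendι g X m ≫ f = extendι g X m ≫ f') :
    f = f' :=
  letI : Module B B' := Module.compHom B' g.toRingHom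
  tensor_hom_ext X h

/-- The morphism `B' ⊗_B X → Y` attached to a `B`-bilinear family of morphisms `X → Y`. -/
noncomputable def extendDesc (g : B →ₐ[A] B') (X : BaseChange A B C) {Y : C}
    (t : B' → (X.obj ⟶ Y)) (hadd : ∀ m n, t (m + n) = t m + t n)
    (hmul : ∀ (b : B) m, t (g b * m) = X.actHom b ≫ t m) : extendTensor g X ⟶ Y :=
  letI : Module B B' := Module.compHom B' g.toRingHom
  tensorDesc X t hadd hmul

@[simp]
lemma extendι_desc (g : B →ₐ[A] B') (X : BaseChange A B C) {Y : C}
    (t : B' → (X.obj ⟶ Y)) (hadd : ∀ m n, t (m + n) = t m + t n)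
    (hmul : ∀ (b : B) m, t (g b * m) = X.actHom b ≫ t m) (m : B') :
    extendι g X m ≫ extendDesc g X t hadd hmul = t m :=
  letI : Module B B' := Module.compHom B' g.toRingHom
  tensorι_desc X t hadd hmul m

/-- Multiplication by `c ∈ B'` on `B' ⊗_B X`: `b' ⊗ x ↦ c b' ⊗ x`. -/
noncomputable def extendAct (g : B →ₐ[A] B') (X : BaseChange A B C) (c : B') :
    extendTensor g X ⟶ extendTensor g X :=
  extendDesc g X (fun b' => extendι g X (c * b'))
    (fun m n => by rw [mul_add, extendι_add])
    (fun b m => by rw [mul_left_comm, extendι_mul])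

@[simp]
lemma extendι_act (g : B →ₐ[A] B') (X : BaseChange A B C) (c m : B') :
    extendι g X m ≫ extendAct g X c = extendι g X (c * m) := by
  simp [extendAct]

lemma extendAct_add (g : B →ₐ[A] B') (X : BaseChange A B C) (c d : B') :
    extendAct g X (c + d) = extendAct g X c + extendAct g X d :=
  extendTensor_hom_ext g X fun m => by
    rw [Preadditive.comp_add, extendι_act, extendι_act, extendι_act, add_mul, extendι_add]

lemma extendAct_smul (g : B →ₐ[A] B') (X : BaseChange A B C) (a : A) (c : B') :
    extendAct g X (a • c) = a • extendAct g X c :=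
  extendTensor_hom_ext g X fun m => by
    have h : extendι g X (g (algebraMap A B a) * (c * m)) = a • extendι g X (c * m) := by
      rw [extendι_mul, X.actHom_algebraMap, Linear.smul_comp, Category.id_comp]
    rw [AlgHom.commutes, ← mul_assoc, ← Algebra.smul_def] at h
    rw [extendι_act, h, Linear.comp_smul, extendι_act]

lemma extendAct_one (g : B →ₐ[A] B') (X : BaseChange A B C) :
    extendAct g X 1 = 𝟙 _ :=
  extendTensor_hom_ext g X fun m => by rw [extendι_act, one_mul, Category.comp_id]

lemma extendAct_mul (g : B →ₐ[A] B') (X : BaseChange A B C) (c d : B') :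
    extendAct g X (c * d) = extendAct g X d ≫ extendAct g X c :=
  extendTensor_hom_ext g X fun m => by
    rw [← Category.assoc, extendι_act, extendι_act, extendι_act, mul_assoc]

/-- The pullback `g^* X` of `X` along `g : B → B'`: the object `B' ⊗_B X` with `B'` acting by
multiplication on the left factor. -/
noncomputable def extendObj (g : B →ₐ[A] B') (X : BaseChange A B C) : BaseChange A B' C where
  obj := extendTensor g X
  act := AlgHom.ofLinearMap
    { toFun := extendAct g X
      map_add' := extendAct_add g X
      map_smul' := extendAct_smul g X }
    (extendAct_one g X) (extendAct_mul g X)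

/-- The canonical morphism `X → g^* X`, `x ↦ 1 ⊗ x`, as a morphism of `C`. -/
noncomputable def extendUnit (g : B →ₐ[A] B') (X : BaseChange A B C) :
    X.obj ⟶ (extendObj g X).obj :=
  extendι g X 1

lemma extendUnit_actHom (g : B →ₐ[A] B') (X : BaseChange A B C) (c : B') :
    extendUnit g X ≫ (extendObj g X).actHom c = extendι g X c :=
  (extendι_act g X c 1).trans (by rw [mul_one])

lemma extendUnit_semilinear (g : B →ₐ[A] B') (X : BaseChange A B C) (b : B) :
    X.actHom b ≫ extendUnit g X = extendUnit g X ≫ (extendObj g X).actHom (g b) :=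
  (extendι_mul g X b 1).symm.trans (by rw [extendUnit_actHom, mul_one])

lemma extend_hom_ext (g : B →ₐ[A] B') {X : BaseChange A B C} {Y : BaseChange A B' C}
    {f f' : extendObj g X ⟶ Y} (h : extendUnit g X ≫ f.hom = extendUnit g X ≫ f'.hom) :
    f = f' := by
  have key (φ : extendObj g X ⟶ Y) (m : B') : (extendUnit g X ≫ (extendObj g X).actHom m) ≫ φ.hom =
      (extendUnit g X ≫ φ.hom) ≫ Y.actHom m := by
    rw [Category.assoc, Category.assoc, φ.comm]
  refine BaseChange.hom_ext (extendTensor_hom_ext g X fun m => ?_)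
  rw [← extendUnit_actHom]
  exact (key f m).trans ((congrArg (· ≫ Y.actHom m) h).trans (key f' m).symm)

/-- The morphism `g^* X → Y`, `b' ⊗ x ↦ b' f x`, as a morphism of `C`. -/
noncomputable def extendLiftHom (g : B →ₐ[A] B') {X : BaseChange A B C} {Y : BaseChange A B' C}
    (f : X.obj ⟶ Y.obj) (hf : ∀ b, X.actHom b ≫ f = f ≫ Y.actHom (g b)) :
    extendTensor g X ⟶ Y.obj :=
  extendDesc g X (fun b' => f ≫ Y.actHom b')
    (fun m n => by rw [Y.actHom_add, Preadditive.comp_add])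
    (fun b m => by rw [← Category.assoc, hf, mul_comm, Y.actHom_mul, Category.assoc])

@[simp]
lemma extendι_liftHom (g : B →ₐ[A] B') {X : BaseChange A B C} {Y : BaseChange A B' C}
    (f : X.obj ⟶ Y.obj) (hf : ∀ b, X.actHom b ≫ f = f ≫ Y.actHom (g b)) (m : B') :
    extendι g X m ≫ extendLiftHom g f hf = f ≫ Y.actHom m := by
  simp [extendLiftHom]

lemma extendAct_liftHom (g : B →ₐ[A] B') {X : BaseChange A B C} {Y : BaseChange A B' C}
    (f : X.obj ⟶ Y.obj) (hf : ∀ b, X.actHom b ≫ f = f ≫ Y.actHom (g b)) (c : B') :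
    extendAct g X c ≫ extendLiftHom g f hf = extendLiftHom g f hf ≫ Y.actHom c :=
  extendTensor_hom_ext g X fun m => by
    rw [← Category.assoc, ← Category.assoc, extendι_act, extendι_liftHom, extendι_liftHom,
      Y.actHom_mul, Category.assoc]

/-- The morphism `g^* X → Y` which corresponds to a morphism `f : X → Y` of `C` that is `B`-linear
when `B` acts on `Y` through `g`. -/
noncomputable def extendLift (g : B →ₐ[A] B') {X : BaseChange A B C} {Y : BaseChange A B' C}
    (f : X.obj ⟶ Y.obj) (hf : ∀ b, X.actHom b ≫ f = f ≫ Y.actHom (g b)) : extendObj g X ⟶ Y where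
  hom := extendLiftHom g f hf
  comm c := extendAct_liftHom g f hf c

@[simp]
lemma extendUnit_lift (g : B →ₐ[A] B') {X : BaseChange A B C} {Y : BaseChange A B' C}
    (f : X.obj ⟶ Y.obj) (hf : ∀ b, X.actHom b ≫ f = f ≫ Y.actHom (g b)) :
    extendUnit g X ≫ (extendLift g f hf).hom = f := by
  have h : extendUnit g X ≫ (extendLift g f hf).hom = f ≫ Y.actHom 1 :=
    extendι_liftHom g f hf 1
  rw [h, Y.actHom_one, Category.comp_id]

@[simp]
lemma extendUnit_lift_assoc (g : B →ₐ[A] B') {X : BaseChange A B C} {Y : BaseChange A B' C}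
    (f : X.obj ⟶ Y.obj) (hf : ∀ b, X.actHom b ≫ f = f ≫ Y.actHom (g b)) {Z : C} (h : Y.obj ⟶ Z) :
    extendUnit g X ≫ (extendLift g f hf).hom ≫ h = f ≫ h := by
  rw [← Category.assoc, extendUnit_lift]

/-- The pullback of a morphism, `b' ⊗ x ↦ b' ⊗ f x`. -/
noncomputable def extendMap (g : B →ₐ[A] B') {X Y : BaseChange A B C} (f : X ⟶ Y) :
    extendObj g X ⟶ extendObj g Y :=
  extendLift g (f.hom ≫ extendUnit g Y) (fun b => by
    rw [← Category.assoc, f.comm, Category.assoc, extendUnit_semilinear, Category.assoc])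

@[simp]
lemma extendUnit_map (g : B →ₐ[A] B') {X Y : BaseChange A B C} (f : X ⟶ Y) :
    extendUnit g X ≫ (extendMap g f).hom = f.hom ≫ extendUnit g Y :=
  extendUnit_lift g _ _

@[simp]
lemma extendUnit_map_assoc (g : B →ₐ[A] B') {X Y : BaseChange A B C} (f : X ⟶ Y) {Z : C}
    (h : (extendObj g Y).obj ⟶ Z) :
    extendUnit g X ≫ (extendMap g f).hom ≫ h = f.hom ≫ extendUnit g Y ≫ h := by
  rw [← Category.assoc, extendUnit_map, Category.assoc]

@[simp]
lemma extendMap_id (g : B →ₐ[A] B') (X : BaseChange A B C) :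
    extendMap g (𝟙 X) = 𝟙 (extendObj g X) :=
  extend_hom_ext g (by simp)

@[simp]
lemma extendMap_comp (g : B →ₐ[A] B') {X Y Z : BaseChange A B C} (f : X ⟶ Y) (f' : Y ⟶ Z) :
    extendMap g (f ≫ f') = extendMap g f ≫ extendMap g f' :=
  extend_hom_ext g (by simp)

/-- The pullback functor `g^*`, `X ↦ B' ⊗_B X`. -/
@[simps]
noncomputable def extend (g : B →ₐ[A] B') : BaseChange A B C ⥤ BaseChange A B' C where
  obj X := extendObj g X
  map f := extendMap g f
  map_id X := extendMap_id g X
  map_comp f f' := extendMap_comp g f f'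

/-- Restriction of the action along `h : B' → B''`. -/
abbrev restrictObj (h : B' →ₐ[A] B'') (Y : BaseChange A B'' C) : BaseChange A B' C where
  obj := Y.obj
  act := Y.act.comp h

lemma extendComp_hom_ext (g : B →ₐ[A] B') (h : B' →ₐ[A] B'') {X : BaseChange A B C}
    {Y : BaseChange A B'' C} {f f' : extendObj h (extendObj g X) ⟶ Y}
    (hf : extendUnit g X ≫ extendUnit h (extendObj g X) ≫ f.hom =
      extendUnit g X ≫ extendUnit h (extendObj g X) ≫ f'.hom) : f = f' := by
  have key (φ : extendObj h (extendObj g X) ⟶ Y) (b : B') :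
      (extendObj g X).actHom b ≫ extendUnit h (extendObj g X) ≫ φ.hom =
        (extendUnit h (extendObj g X) ≫ φ.hom) ≫ (restrictObj h Y).actHom b := by
    rw [← Category.assoc, extendUnit_semilinear, Category.assoc, φ.comm, Category.assoc]
    rfl
  let ψ (φ : extendObj h (extendObj g X) ⟶ Y) : extendObj g X ⟶ restrictObj h Y :=
    ⟨extendUnit h (extendObj g X) ≫ φ.hom, key φ⟩
  have hψ : ψ f = ψ f' := extend_hom_ext g hf
  exact extend_hom_ext h (congrArg BaseChange.Hom.hom hψ)

/-- The morphism `h^* (g^* X) → k^* X`, `1 ⊗ (1 ⊗ x) ↦ 1 ⊗ x`, for `k = h ∘ g`. -/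
noncomputable def extendCompInv (g : B →ₐ[A] B') (h : B' →ₐ[A] B'') (k : B →ₐ[A] B'')
    (e : h.comp g = k) (X : BaseChange A B C) :
    extendObj h (extendObj g X) ⟶ extendObj k X :=
  let φ : extendObj g X ⟶ restrictObj h (extendObj k X) :=
    extendLift g (extendUnit k X) (fun b => by subst e; exact extendUnit_semilinear _ X b)
  extendLift h φ.hom φ.comm

@[simp]
lemma extendUnit_compInv (g : B →ₐ[A] B') (h : B' →ₐ[A] B'') (k : B →ₐ[A] B'')
    (e : h.comp g = k) (X : BaseChange A B C) :
    extendUnit g X ≫ extendUnit h (extendObj g X) ≫ (extendCompInv g h k e X).hom =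
      extendUnit k X :=
  (congrArg (extendUnit g X ≫ ·) (extendUnit_lift h (Y := extendObj k X) _ _)).trans
    (extendUnit_lift (Y := restrictObj h (extendObj k X)) g (extendUnit k X)
      (fun b => by subst e; exact extendUnit_semilinear _ X b))

/-- The canonical isomorphism `k^* X ≅ h^* (g^* X)` for `k = h ∘ g`, i.e.
`B'' ⊗_B X ≅ B'' ⊗_{B'} (B' ⊗_B X)`, under which `1 ⊗ x` corresponds to `1 ⊗ (1 ⊗ x)`. -/
noncomputable def extendComp (g : B →ₐ[A] B') (h : B' →ₐ[A] B'') (k : B →ₐ[A] B'')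
    (e : h.comp g = k) (X : BaseChange A B C) :
    extendObj k X ≅ extendObj h (extendObj g X) where
  hom := extendLift k (extendUnit g X ≫ extendUnit h (extendObj g X)) (fun b => by
    subst e
    rw [← Category.assoc, extendUnit_semilinear, Category.assoc, extendUnit_semilinear,
      Category.assoc]
    rfl)
  inv := extendCompInv g h k e X
  hom_inv_id := extend_hom_ext k (by simp)
  inv_hom_id := extendComp_hom_ext g h (by
    have H := extendUnit_compInv g h k e X
    rw [BaseChange.comp_hom, ← Category.assoc (extendUnit h _), ← Category.assoc, H]
    simp)

@[simp]
lemma extendUnit_comp_hom (g : B →ₐ[A] B') (h : B' →ₐ[A] B'') (k : B →ₐ[A] B'')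
    (e : h.comp g = k) (X : BaseChange A B C) :
    extendUnit k X ≫ (extendComp g h k e X).hom.hom =
      extendUnit g X ≫ extendUnit h (extendObj g X) :=
  extendUnit_lift _ _ _

@[simp]
lemma extendUnit_comp_inv (g : B →ₐ[A] B') (h : B' →ₐ[A] B'') (k : B →ₐ[A] B'')
    (e : h.comp g = k) (X : BaseChange A B C) :
    extendUnit g X ≫ extendUnit h (extendObj g X) ≫ (extendComp g h k e X).inv.hom =
      extendUnit k X :=
  extendUnit_compInv g h k e X

@[simp]
lemma extendUnit_comp_hom_assoc (g : B →ₐ[A] B') (h : B' →ₐ[A] B'') (k : B →ₐ[A] B'')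
    (e : h.comp g = k) (X : BaseChange A B C) {Z : C}
    (f : (extendObj h (extendObj g X)).obj ⟶ Z) :
    extendUnit k X ≫ (extendComp g h k e X).hom.hom ≫ f =
      extendUnit g X ≫ extendUnit h (extendObj g X) ≫ f := by
  rw [← Category.assoc, extendUnit_comp_hom, Category.assoc]

@[simp]
lemma extendUnit_comp_inv_assoc (g : B →ₐ[A] B') (h : B' →ₐ[A] B'') (k : B →ₐ[A] B'')
    (e : h.comp g = k) (X : BaseChange A B C) {Z : C} (f : (extendObj k X).obj ⟶ Z) :
    extendUnit g X ≫ extendUnit h (extendObj g X) ≫ (extendComp g h k e X).inv.hom ≫ f =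
      extendUnit k X ≫ f := by
  rw [← extendUnit_comp_inv g h k e X, Category.assoc, Category.assoc]

/-- The pullback along `h` of a morphism `g₁^* X → g₂^* Y`, seen as a morphism `k₁^* X → k₂^* Y`
with `k₁ = h ∘ g₁` and `k₂ = h ∘ g₂`. -/
noncomputable def pullHom {g₁ g₂ : B →ₐ[A] B'} (h : B' →ₐ[A] B'') (k₁ k₂ : B →ₐ[A] B'')
    (e₁ : h.comp g₁ = k₁) (e₂ : h.comp g₂ = k₂) {X Y : BaseChange A B C}
    (φ : extendObj g₁ X ⟶ extendObj g₂ Y) : extendObj k₁ X ⟶ extendObj k₂ Y :=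
  (extendComp g₁ h k₁ e₁ X).hom ≫ extendMap h φ ≫ (extendComp g₂ h k₂ e₂ Y).inv

lemma pullHom_canonical {R R' : Type w} [CommRing R] [Algebra A R] [CommRing R'] [Algebra A R']
    (F : R →ₐ[A] R') (g₁ g₂ : R' →ₐ[A] B') (r : R →ₐ[A] B') (a₁ : g₁.comp F = r)
    (a₂ : g₂.comp F = r) (h : B' →ₐ[A] B'') (k₁ k₂ : R' →ₐ[A] B'') (e₁ : h.comp g₁ = k₁)
    (e₂ : h.comp g₂ = k₂) (s : R →ₐ[A] B'') (c₁ : k₁.comp F = s) (c₂ : k₂.comp F = s)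
    (X : BaseChange A R C) :
    pullHom h k₁ k₂ e₁ e₂ ((extendComp F g₁ r a₁ X).inv ≫ (extendComp F g₂ r a₂ X).hom) =
      (extendComp F k₁ s c₁ X).inv ≫ (extendComp F k₂ s c₂ X).hom :=
  extendComp_hom_ext F k₁ (by simp [pullHom])

lemma canonical_naturality {R R' : Type w} [CommRing R] [Algebra A R] [CommRing R'] [Algebra A R']
    (F : R →ₐ[A] R') (g₁ g₂ : R' →ₐ[A] B') (r : R →ₐ[A] B') (a₁ : g₁.comp F = r)
    (a₂ : g₂.comp F = r) {X Y : BaseChange A R C} (f : X ⟶ Y) :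
    ((extendComp F g₁ r a₁ X).inv ≫ (extendComp F g₂ r a₂ X).hom) ≫
        extendMap g₂ (extendMap F f) =
      extendMap g₁ (extendMap F f) ≫
        (extendComp F g₁ r a₁ Y).inv ≫ (extendComp F g₂ r a₂ Y).hom :=
  extendComp_hom_ext F g₁ (by simp)

end Extend

/-! ### Descent data -/

section Descent

variable (A A' : Type w) [CommRing A] [CommRing A'] [Algebra A A']

/-- The coordinate ring of `S'' = S' ×_S S'`. -/
abbrev Ring₂ : Type w := A' ⊗[A] A'

/-- The coordinate ring of `S' ×_S S' ×_S S'`. -/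
abbrev Ring₃ : Type w := A' ⊗[A] A' ⊗[A] A'

/-- The first projection `S'' → S'`: `a ↦ a ⊗ 1`. -/
abbrev p₁ : A' →ₐ[A] Ring₂ A A' := Algebra.TensorProduct.includeLeft

/-- The second projection `S'' → S'`: `a ↦ 1 ⊗ a`. -/
abbrev p₂ : A' →ₐ[A] Ring₂ A A' := Algebra.TensorProduct.includeRight

/-- The first projection from the triple product: `a ↦ a ⊗ 1 ⊗ 1`. -/
abbrev q₁ : A' →ₐ[A] Ring₃ A A' :=
  (Algebra.TensorProduct.includeLeft : Ring₂ A A' →ₐ[A] Ring₃ A A').comp (p₁ A A')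

/-- The second projection from the triple product: `a ↦ 1 ⊗ a ⊗ 1`. -/
abbrev q₂ : A' →ₐ[A] Ring₃ A A' :=
  (Algebra.TensorProduct.includeLeft : Ring₂ A A' →ₐ[A] Ring₃ A A').comp (p₂ A A')

/-- The third projection from the triple product: `a ↦ 1 ⊗ 1 ⊗ a`. -/
abbrev q₃ : A' →ₐ[A] Ring₃ A A' := Algebra.TensorProduct.includeRight

/-- The projection to the first two factors: `a ⊗ b ↦ a ⊗ b ⊗ 1`. -/
abbrev q₁₂ : Ring₂ A A' →ₐ[A] Ring₃ A A' :=
  Algebra.TensorProduct.productMap (q₁ A A') (q₂ A A')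

/-- The projection to the last two factors: `a ⊗ b ↦ 1 ⊗ a ⊗ b`. -/
abbrev q₂₃ : Ring₂ A A' →ₐ[A] Ring₃ A A' :=
  Algebra.TensorProduct.productMap (q₂ A A') (q₃ A A')

/-- The projection to the outer factors: `a ⊗ b ↦ a ⊗ 1 ⊗ b`. -/
abbrev q₁₃ : Ring₂ A A' →ₐ[A] Ring₃ A A' :=
  Algebra.TensorProduct.productMap (q₁ A A') (q₃ A A')

variable (C : Type u) [Category.{v} C] [Abelian C] [Linear A C]
  [HasFilteredColimitsOfSize.{w, w} C]

/-- Descent data on `C' = C ×_S S'` relative to `S'' = S' ×_S S'`: an object `X'` of `C'` with an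
isomorphism `φ : p₁^* X' ≅ p₂^* X'` over `S''` which satisfies the cocycle condition
`q₂₃^* φ ∘ q₁₂^* φ = q₁₃^* φ` over `S' ×_S S' ×_S S'`. -/
structure DescentData where
  /-- the object over `S'` -/
  obj : BaseChange A A' C
  /-- the gluing isomorphism -/
  iso : extendObj (p₁ A A') obj ≅ extendObj (p₂ A A') obj
  cocycle :
    pullHom (q₁₂ A A') (q₁ A A') (q₂ A A') (Algebra.TensorProduct.productMap_left _ _)
        (Algebra.TensorProduct.productMap_right _ _) iso.hom ≫
      pullHom (q₂₃ A A') (q₂ A A') (q₃ A A') (Algebra.TensorProduct.productMap_left _ _)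
        (Algebra.TensorProduct.productMap_right _ _) iso.hom =
    pullHom (q₁₃ A A') (q₁ A A') (q₃ A A') (Algebra.TensorProduct.productMap_left _ _)
        (Algebra.TensorProduct.productMap_right _ _) iso.hom

variable {A A' C}

/-- Morphisms of descent data: morphisms of `C'` compatible with the gluing isomorphisms. -/
@[ext]
structure DescentData.Hom (X Y : DescentData A A' C) where
  /-- the morphism over `S'` -/
  hom : X.obj ⟶ Y.obj
  comm : X.iso.hom ≫ extendMap (p₂ A A') hom = extendMap (p₁ A A') hom ≫ Y.iso.hom

instance : Category (DescentData A A' C) where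
  Hom X Y := DescentData.Hom X Y
  id X := ⟨𝟙 X.obj, by simp⟩
  comp f g := ⟨f.hom ≫ g.hom, by
    rw [extendMap_comp, extendMap_comp, ← Category.assoc, f.comm, Category.assoc, g.comm,
      Category.assoc]⟩

@[ext]
lemma DescentData.hom_ext {X Y : DescentData A A' C} {f g : X ⟶ Y} (h : f.hom = g.hom) : f = g :=
  DescentData.Hom.ext h

@[simp] lemma DescentData.id_hom (X : DescentData A A' C) : (𝟙 X : X ⟶ X).hom = 𝟙 X.obj := rfl

@[simp] lemma DescentData.comp_hom {X Y Z : DescentData A A' C} (f : X ⟶ Y) (g : Y ⟶ Z) :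
    (f ≫ g).hom = f.hom ≫ g.hom := rfl

variable (A A' C)

/-- The pullback functor `f^* : C → C'`, `X ↦ A' ⊗_A X`, of `f : S' → S`. -/
noncomputable def pullback : C ⥤ BaseChange A A' C :=
  BaseChange.ofBase A C ⋙ extend (Algebra.ofId A A')

/-- The canonical isomorphism `p₁^* f^* X ≅ p₂^* f^* X`: both sides are identified with the
pullback of `X` to `S''`. -/
noncomputable def pullbackIso (X : C) :
    extendObj (p₁ A A') ((pullback A A' C).obj X) ≅ extendObj (p₂ A A') ((pullback A A' C).obj X) :=
  (extendComp (Algebra.ofId A A') (p₁ A A') (Algebra.ofId A (Ring₂ A A'))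
      (Subsingleton.elim _ _) ((BaseChange.ofBase A C).obj X)).symm ≪≫
    extendComp (Algebra.ofId A A') (p₂ A A') (Algebra.ofId A (Ring₂ A A'))
      (Subsingleton.elim _ _) ((BaseChange.ofBase A C).obj X)

/-- The natural functor `C → Desc_{S''}(C')`: it sends `X` to `f^* X` with its canonical
descent datum. -/
noncomputable def toDescentData : C ⥤ DescentData A A' C where
  obj X :=
    { obj := (pullback A A' C).obj X
      iso := pullbackIso A A' C X
      cocycle := by
        have key := fun (h : Ring₂ A A' →ₐ[A] Ring₃ A A') (k₁ k₂ : A' →ₐ[A] Ring₃ A A')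
            (e₁ : h.comp (p₁ A A') = k₁) (e₂ : h.comp (p₂ A A') = k₂) =>
          pullHom_canonical (Algebra.ofId A A') (p₁ A A') (p₂ A A') (Algebra.ofId A (Ring₂ A A'))
            (Subsingleton.elim _ _) (Subsingleton.elim _ _) h k₁ k₂ e₁ e₂
            (Algebra.ofId A (Ring₃ A A')) (Subsingleton.elim _ _) (Subsingleton.elim _ _)
            ((BaseChange.ofBase A C).obj X)
        refine (congrArg₂ (· ≫ ·) (key _ _ _ _ _) (key _ _ _ _ _)).trans
          (Eq.trans ?_ (key _ _ _ _ _).symm)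
        simp }
  map f :=
    { hom := (pullback A A' C).map f
      comm := canonical_naturality (Algebra.ofId A A') (p₁ A A') (p₂ A A')
        (Algebra.ofId A (Ring₂ A A')) (Subsingleton.elim _ _) (Subsingleton.elim _ _)
        ((BaseChange.ofBase A C).map f) }
  map_id X := DescentData.hom_ext ((pullback A A' C).map_id X)
  map_comp f g := DescentData.hom_ext ((pullback A A' C).map_comp f g)

end Descent

end LinearDescent

namespace LinearDescent

/-! ### Functoriality of the tensor product -/

section Functoriality

variable {A B : Type w} [CommRing A] [CommRing B] [Algebra A B]
  {C : Type u} [Category.{v} C] [Abelian C] [Linear A C] [HasFilteredColimitsOfSize.{w, w} C]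
  {M N P : Type w} [AddCommGroup M] [Module B M] [AddCommGroup N] [Module B N]
  [AddCommGroup P] [Module B P]

/-- The morphism `M ⊗ X → N ⊗ X` induced by a linear map `M → N`. -/
noncomputable def tensorMapLeft (X : BaseChange A B C) (f : M →ₗ[B] N) :
    tensor M X ⟶ tensor N X :=
  tensorDesc X (fun m => tensorι X (f m)) (fun m n => by rw [map_add, tensorι_add])
    (fun b m => by rw [map_smul, tensorι_smul])

@[simp]
lemma tensorι_mapLeft (X : BaseChange A B C) (f : M →ₗ[B] N) (m : M) :
    tensorι X m ≫ tensorMapLeft X f = tensorι X (f m) :=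
  tensorι_desc X _ _ _ m

lemma tensorMapLeft_id (X : BaseChange A B C) :
    tensorMapLeft X (LinearMap.id : M →ₗ[B] M) = 𝟙 _ :=
  tensor_hom_ext X fun m => by simp

lemma tensorMapLeft_comp (X : BaseChange A B C) (f : M →ₗ[B] N) (g : N →ₗ[B] P) :
    tensorMapLeft X (g.comp f) = tensorMapLeft X f ≫ tensorMapLeft X g :=
  tensor_hom_ext X fun m => by
    rw [← Category.assoc, tensorι_mapLeft, tensorι_mapLeft, tensorι_mapLeft, LinearMap.comp_apply]

variable (M) in
/-- The morphism `M ⊗ X → M ⊗ Y` induced by a morphism `X → Y`. -/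
noncomputable def tensorMapRight {X Y : BaseChange A B C} (f : X ⟶ Y) :
    tensor M X ⟶ tensor M Y :=
  tensorDesc X (fun m => f.hom ≫ tensorι Y m)
    (fun m n => by rw [tensorι_add, Preadditive.comp_add])
    (fun b m => by rw [tensorι_smul, ← Category.assoc, ← Category.assoc, f.comm])

@[simp]
lemma tensorι_mapRight {X Y : BaseChange A B C} (f : X ⟶ Y) (m : M) :
    tensorι X m ≫ tensorMapRight M f = f.hom ≫ tensorι Y m :=
  tensorι_desc X _ _ _ m

lemma tensorMapRight_id (X : BaseChange A B C) :
    tensorMapRight M (𝟙 X) = 𝟙 _ :=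
  tensor_hom_ext X fun m => by simp

lemma tensorMapRight_comp {X Y Z : BaseChange A B C} (f : X ⟶ Y) (g : Y ⟶ Z) :
    tensorMapRight M (f ≫ g) = tensorMapRight M f ≫ tensorMapRight M g :=
  tensor_hom_ext X fun m => by
    rw [← Category.assoc, tensorι_mapRight, tensorι_mapRight, Category.assoc, tensorι_mapRight,
      BaseChange.comp_hom, Category.assoc]

lemma tensorMapLeft_mapRight {X Y : BaseChange A B C} (f : X ⟶ Y) (g : M →ₗ[B] N) :
    tensorMapLeft X g ≫ tensorMapRight N f = tensorMapRight M f ≫ tensorMapLeft Y g :=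
  tensor_hom_ext X fun m => by
    rw [← Category.assoc, ← Category.assoc, tensorι_mapLeft, tensorι_mapRight, tensorι_mapRight,
      Category.assoc, tensorι_mapLeft]

/-- The morphism `M ⊗ X → X` attached to a linear form on `M`. -/
noncomputable def tensorEval (X : BaseChange A B C) (l : M →ₗ[B] B) : tensor M X ⟶ X.obj :=
  tensorDesc X (fun m => X.actHom (l m)) (fun m n => by rw [map_add, X.actHom_add])
    (fun b m => by rw [map_smul, smul_eq_mul, mul_comm, X.actHom_mul])

@[simp]
lemma tensorι_eval (X : BaseChange A B C) (l : M →ₗ[B] B) (m : M) :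
    tensorι X m ≫ tensorEval X l = X.actHom (l m) :=
  tensorι_desc X _ _ _ m

lemma tensorEval_naturality {X Y : BaseChange A B C} (f : X ⟶ Y) (l : M →ₗ[B] B) :
    tensorMapRight M f ≫ tensorEval Y l = tensorEval X l ≫ f.hom :=
  tensor_hom_ext X fun m => by
    rw [← Category.assoc, ← Category.assoc, tensorι_mapRight, tensorι_eval, Category.assoc,
      tensorι_eval, f.comm]

lemma tensorι_sum (X : BaseChange A B C) {ι : Type*} (s : Finset ι) (m : ι → M) :
    tensorι X (∑ i ∈ s, m i) = ∑ i ∈ s, tensorι X (m i) :=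
  map_sum (AddMonoidHom.mk' (tensorι X (M := M)) (tensorι_add X)) m s

lemma sum_tensorEval_tensorι (X : BaseChange A B C) {ι : Type} [Fintype ι] [DecidableEq ι]
    (l : ι → M →ₗ[B] B) (e : ι → M) (h : ∀ m, ∑ i, l i m • e i = m) :
    ∑ i, tensorEval X (l i) ≫ tensorι X (e i) = 𝟙 (tensor M X) :=
  tensor_hom_ext X fun m => by
    rw [Preadditive.comp_sum, Category.comp_id]
    conv_rhs => rw [← h m, tensorι_sum]
    refine Finset.sum_congr rfl fun i _ => ?_
    rw [← Category.assoc, tensorι_eval, tensorι_smul]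

end Functoriality

/-! ### The canonical diagram of finite free modules over a module -/

section FreeOver

variable (B M : Type w) [CommRing B] [AddCommGroup M] [Module B M]

/-- Finite free modules `B^n` with a linear map to `M`. -/
structure FreeOver where
  /-- the rank -/
  rank : ℕ
  /-- the structure map -/
  map : (Fin rank → B) →ₗ[B] M

variable {B M}

namespace FreeOver

/-- Morphisms are the linear maps over `M`. -/
@[ext]
structure Hom (X Y : FreeOver B M) where
  /-- the underlying linear map -/
  lin : (Fin X.rank → B) →ₗ[B] (Fin Y.rank → B)
  comm : Y.map.comp lin = X.map

instance : Category (FreeOver B M) where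
  Hom X Y := Hom X Y
  id X := ⟨LinearMap.id, rfl⟩
  comp f g := ⟨g.lin.comp f.lin, by rw [← LinearMap.comp_assoc, g.comm, f.comm]⟩

lemma hom_ext {X Y : FreeOver B M} {f g : X ⟶ Y} (h : f.lin = g.lin) : f = g :=
  Hom.ext h

@[simp] lemma comp_lin {X Y Z : FreeOver B M} (f : X ⟶ Y) (g : Y ⟶ Z) :
    (f ≫ g).lin = g.lin.comp f.lin := rfl

lemma map_lin {X Y : FreeOver B M} (f : X ⟶ Y) (x : Fin X.rank → B) :
    Y.map (f.lin x) = X.map x := LinearMap.congr_fun f.comm x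

/-- The free module of rank one over `M` given by an element of `M`. -/
abbrev point (m : M) : FreeOver B M where
  rank := 1
  map := (LinearMap.toSpanSingleton B M m).comp (LinearMap.proj 0)

/-- The basis vector of `point m`. -/
def pointGen (B : Type w) [CommRing B] : Fin 1 → B := fun _ => 1

lemma point_map_gen (m : M) : (point (B := B) m).map (pointGen B) = m := by
  simp [pointGen]

/-- A vector of `X` over `m` defines a morphism from `point m`. -/
def ofPoint {X : FreeOver B M} (x : Fin X.rank → B) (m : M) (h : X.map x = m) : point m ⟶ X where
  lin := (LinearMap.toSpanSingleton B _ x).comp (LinearMap.proj (0 : Fin 1))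
  comm := by
    subst h
    apply LinearMap.ext
    intro y
    simp

lemma ofPoint_lin {X : FreeOver B M} (x : Fin X.rank → B) (m : M) (h : X.map x = m) :
    (ofPoint x m h).lin (pointGen B) = x := by
  ext i
  simp [ofPoint, pointGen]

/-- The direct sum of two free modules over `M`. -/
def sum (X Y : FreeOver B M) : FreeOver B M where
  rank := X.rank + Y.rank
  map := (X.map.coprod Y.map).comp
    ((LinearMap.funLeft B B (Fin.castAdd Y.rank)).prod (LinearMap.funLeft B B (Fin.natAdd X.rank)))

/-- The first inclusion into the direct sum. -/
def inl (X Y : FreeOver B M) : X ⟶ sum X Y where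
  lin := LinearMap.pi fun i => Fin.addCases (fun j => LinearMap.proj j) (fun _ => 0) i
  comm := by
    apply LinearMap.ext
    intro x
    have h1 : (fun i => Fin.addCases (motive := fun _ => (Fin X.rank → B) →ₗ[B] B)
        (fun j => LinearMap.proj j) (fun _ : Fin Y.rank => 0) (Fin.castAdd Y.rank i) x) = x := by
      ext i; simp
    have h2 : (fun i => Fin.addCases (motive := fun _ => (Fin X.rank → B) →ₗ[B] B)
        (fun j => LinearMap.proj j) (fun _ : Fin Y.rank => 0) (Fin.natAdd X.rank i) x) = 0 := by
      ext i; simp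
    refine (congrArg₂ (· + ·) (congrArg X.map h1) (congrArg Y.map h2)).trans ?_
    simp

/-- The second inclusion into the direct sum. -/
def inr (X Y : FreeOver B M) : Y ⟶ sum X Y where
  lin := LinearMap.pi fun i => Fin.addCases (fun _ => 0) (fun j => LinearMap.proj j) i
  comm := by
    apply LinearMap.ext
    intro x
    have h1 : (fun i => Fin.addCases (motive := fun _ => (Fin Y.rank → B) →ₗ[B] B)
        (fun _ : Fin X.rank => 0) (fun j => LinearMap.proj j) (Fin.castAdd Y.rank i) x) = 0 := by
      ext i; simp
    have h2 : (fun i => Fin.addCases (motive := fun _ => (Fin Y.rank → B) →ₗ[B] B)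
        (fun _ : Fin X.rank => 0) (fun j => LinearMap.proj j) (Fin.natAdd X.rank i) x) = x := by
      ext i; simp
    refine (congrArg₂ (· + ·) (congrArg X.map h1) (congrArg Y.map h2)).trans ?_
    simp

instance isFiltered [Module.Flat B M] : IsFiltered (FreeOver B M) where
  nonempty := ⟨point 0⟩
  cocone_objs X Y := ⟨sum X Y, inl X Y, inr X Y, trivial⟩
  cocone_maps X Y f g := by
    have h : Y.map.comp (f.lin - g.lin) = 0 := by
      rw [LinearMap.comp_sub, f.comm, g.comm, sub_self]
    obtain ⟨k, a, y, hy, ha⟩ := Module.Flat.exists_factorization_of_comp_eq_zero_of_free h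
    let e := Finsupp.linearEquivFunOnFinite B B (Fin k)
    refine ⟨⟨k, y.comp e.symm.toLinearMap⟩, ⟨e.toLinearMap.comp a, ?_⟩, hom_ext ?_⟩
    · rw [hy]
      apply LinearMap.ext
      intro x
      simp
    · have ha' : a.comp f.lin = a.comp g.lin := by
        rw [← sub_eq_zero, ← ha, LinearMap.comp_sub]
      simp only [comp_lin, LinearMap.comp_assoc, ha']

end FreeOver

end FreeOver

section Lazard

variable {A B : Type w} [CommRing A] [CommRing B] [Algebra A B]
  {C : Type u} [Category.{v} C] [Abelian C] [Linear A C] [HasFilteredColimitsOfSize.{w, w} C]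
  (M : Type w) [AddCommGroup M] [Module B M]

/-- The diagram `B^n ⊗ X` indexed by the finite free modules over `M`. -/
noncomputable def freeDiagram (X : BaseChange A B C) : FreeOver B M ⥤ C where
  obj j := tensor (Fin j.rank → B) X
  map f := tensorMapLeft X f.lin
  map_id _ := tensorMapLeft_id X
  map_comp f g := tensorMapLeft_comp X f.lin g.lin

variable {M} in
/-- The legs of a cocone over the diagram of the `B^n ⊗ X`. -/
noncomputable def coconeLeg {X : BaseChange A B C} (s : Cocone (freeDiagram M X))
    (j : FreeOver B M) : tensor (Fin j.rank → B) X ⟶ s.pt := s.ι.app j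

variable {M} in
lemma coconeLeg_w {X : BaseChange A B C} (s : Cocone (freeDiagram M X)) {i j : FreeOver B M}
    (f : i ⟶ j) : tensorMapLeft X f.lin ≫ coconeLeg s j = coconeLeg s i := s.w f

/-- The cocone with vertex `M ⊗ X` over the diagram of the `B^n ⊗ X`. -/
noncomputable def freeCocone (X : BaseChange A B C) : Cocone (freeDiagram M X) where
  pt := tensor M X
  ι :=
    { app j := tensorMapLeft X j.map
      naturality i j f := by
        refine Eq.trans ?_ (Category.comp_id _).symm
        exact (tensorMapLeft_comp X _ _).symm.trans (congrArg _ f.comm) }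

variable {M} in
/-- The family of morphisms indexed by `M` which defines a cocone over the diagram
of the `B^n ⊗ X`. -/
noncomputable def coconeFamily {X : BaseChange A B C} (s : Cocone (freeDiagram M X)) (m : M) :
    X.obj ⟶ s.pt :=
  tensorι X (FreeOver.pointGen B) ≫ coconeLeg s (FreeOver.point m)

variable {M} in
lemma tensorι_coconeLeg {X : BaseChange A B C} (s : Cocone (freeDiagram M X)) (j : FreeOver B M)
    (x : Fin j.rank → B) : tensorι X x ≫ coconeLeg s j = coconeFamily s (j.map x) := by
  rw [coconeFamily, ← coconeLeg_w s (FreeOver.ofPoint x _ rfl), ← Category.assoc, tensorι_mapLeft,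
    FreeOver.ofPoint_lin]

variable {M} in
lemma coconeFamily_add {X : BaseChange A B C} (s : Cocone (freeDiagram M X)) (m n : M) :
    coconeFamily s (m + n) = coconeFamily s m + coconeFamily s n := by
  let j := FreeOver.sum (FreeOver.point (B := B) m) (FreeOver.point n)
  obtain ⟨x, hx⟩ : ∃ x, j.map x = m := ⟨(FreeOver.inl (FreeOver.point (B := B) m)
    (FreeOver.point n)).lin (FreeOver.pointGen B),
    (FreeOver.map_lin _ _).trans (FreeOver.point_map_gen m)⟩
  obtain ⟨y, hy⟩ : ∃ y, j.map y = n := ⟨(FreeOver.inr (FreeOver.point (B := B) m)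
    (FreeOver.point n)).lin (FreeOver.pointGen B),
    (FreeOver.map_lin _ _).trans (FreeOver.point_map_gen n)⟩
  have h := tensorι_coconeLeg s j (x + y)
  rw [tensorι_add, Preadditive.add_comp, tensorι_coconeLeg, tensorι_coconeLeg, map_add, hx, hy] at h
  exact h.symm

variable {M} in
lemma coconeFamily_smul {X : BaseChange A B C} (s : Cocone (freeDiagram M X)) (b : B) (m : M) :
    coconeFamily s (b • m) = X.actHom b ≫ coconeFamily s m := by
  have h := tensorι_coconeLeg s (FreeOver.point m) (b • FreeOver.pointGen B)
  rw [tensorι_smul, Category.assoc, map_smul, FreeOver.point_map_gen] at h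
  exact h.symm

/-- `M ⊗ X` is the colimit of the `B^n ⊗ X` over the finite free modules over `M`. -/
noncomputable def freeCoconeIsColimit (X : BaseChange A B C) : IsColimit (freeCocone M X) where
  desc s := tensorDesc X (coconeFamily s) (coconeFamily_add s) (coconeFamily_smul s)
  fac s j := by
    change tensorMapLeft X j.map ≫ tensorDesc X _ _ _ = coconeLeg s j
    refine tensor_hom_ext X fun x => ?_
    rw [← Category.assoc, tensorι_mapLeft, tensorι_desc, tensorι_coconeLeg]
  uniq s f hf := by
    refine tensor_hom_ext X fun m => ?_
    have h : tensorMapLeft X (FreeOver.point m).map ≫ f = coconeLeg s (FreeOver.point m) :=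
      hf (FreeOver.point m)
    have h' := tensorι_mapLeft X (FreeOver.point m).map (FreeOver.pointGen B)
    rw [FreeOver.point_map_gen] at h'
    rw [tensorι_desc, coconeFamily, ← h, ← h']
    exact Category.assoc _ _ _

end Lazard

/-! ### Exactness of the tensor product with a flat module -/

section Retract

universe v₁ u₁

variable {C : Type u} [Category.{v} C] [Preadditive C]

/-- A functor which is a retract of a finite sum of copies of the identity preserves limits. -/
lemma preservesLimitsOfShape_of_sum_comp_eq_id {J : Type u₁} [Category.{v₁} J] (F : C ⥤ C)
    {n : ℕ} (π : Fin n → (F ⟶ 𝟭 C)) (ι : Fin n → (𝟭 C ⟶ F))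
    (h : ∀ X, ∑ i, (π i).app X ≫ (ι i).app X = 𝟙 (F.obj X)) : PreservesLimitsOfShape J F where
  preservesLimit {K} := ⟨fun {c} hc => by
    let comp (i : Fin n) (X : C) : F.obj X ⟶ X := (π i).app X
    have comp_nat (i : Fin n) {X Y : C} (f : X ⟶ Y) : F.map f ≫ comp i Y = comp i X ≫ f :=
      (π i).naturality f
    let incl (i : Fin n) (X : C) : X ⟶ F.obj X := (ι i).app X
    have incl_nat (i : Fin n) {X Y : C} (f : X ⟶ Y) : incl i X ≫ F.map f = f ≫ incl i Y :=
      ((ι i).naturality f).symm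
    have h' (X : C) : ∑ i, comp i X ≫ incl i X = 𝟙 (F.obj X) := h X
    let leg (s : Cone (K ⋙ F)) (j : J) : s.pt ⟶ F.obj (K.obj j) := s.π.app j
    have leg_w (s : Cone (K ⋙ F)) {j j' : J} (f : j ⟶ j') :
        leg s j ≫ F.map (K.map f) = leg s j' := s.w f
    let cone (s : Cone (K ⋙ F)) (i : Fin n) : Cone K :=
      { pt := s.pt
        π :=
          { app j := leg s j ≫ comp i (K.obj j)
            naturality j j' f := by
              refine (Category.id_comp _).trans ?_
              rw [Category.assoc, ← comp_nat, ← Category.assoc, leg_w] } }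
    have hfac (s : Cone (K ⋙ F)) (i : Fin n) (j : J) :
        hc.lift (cone s i) ≫ c.π.app j = leg s j ≫ comp i (K.obj j) := hc.fac (cone s i) j
    refine ⟨{ lift s := ∑ i, hc.lift (cone s i) ≫ incl i c.pt, fac s j := ?_, uniq s m hm := ?_ }⟩
    · change (∑ i, hc.lift (cone s i) ≫ incl i c.pt) ≫ F.map (c.π.app j) = leg s j
      rw [Preadditive.sum_comp]
      conv_rhs => rw [← Category.comp_id (leg s j), ← h', Preadditive.comp_sum]
      refine Finset.sum_congr rfl fun i _ => ?_
      have := hfac s i j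
      rw [Category.assoc, incl_nat]
      refine (Category.assoc _ _ _).symm.trans ((congrArg (· ≫ incl i _) this).trans ?_)
      exact Category.assoc _ _ _
    · let m' : s.pt ⟶ F.obj c.pt := m
      have hm' (j : J) : m' ≫ F.map (c.π.app j) = leg s j := hm j
      have key (i : Fin n) : m' ≫ comp i c.pt = hc.lift (cone s i) :=
        hc.uniq (cone s i) _ fun j => by
          change (m' ≫ comp i c.pt) ≫ c.π.app j = leg s j ≫ comp i (K.obj j)
          rw [← hm', Category.assoc, Category.assoc, comp_nat]
      change m' = _
      rw [← Category.comp_id m', ← h', Preadditive.comp_sum]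
      refine Finset.sum_congr rfl fun i _ => ?_
      rw [← key, Category.assoc]⟩

end Retract

section Exactness

variable {A : Type w} [CommRing A]
  {C : Type u} [Category.{v} C] [Abelian C] [Linear A C] [HasFilteredColimitsOfSize.{w, w} C]
  (M : Type w) [AddCommGroup M] [Module A M]

variable (C) in
/-- The functor `X ↦ M ⊗ X`. -/
noncomputable def tensorFunctor : C ⥤ C where
  obj X := tensor M ((BaseChange.ofBase A C).obj X)
  map f := tensorMapRight M ((BaseChange.ofBase A C).map f)
  map_id X := (congrArg (tensorMapRight M) ((BaseChange.ofBase A C).map_id X)).trans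
    (tensorMapRight_id _)
  map_comp f g := (congrArg (tensorMapRight M) ((BaseChange.ofBase A C).map_comp f g)).trans
    (tensorMapRight_comp _ _)

variable (C) in
lemma tensorFunctor_free_preservesLimitsOfShape (n : ℕ) (J : Type) [SmallCategory J] :
    PreservesLimitsOfShape J (tensorFunctor C (A := A) (Fin n → A)) := by
  refine preservesLimitsOfShape_of_sum_comp_eq_id _
    (fun i => { app X := tensorEval _ (LinearMap.proj i), naturality X Y f := ?_ })
    (fun i => { app X := tensorι ((BaseChange.ofBase A C).obj X) (Pi.single i (1 : A)),
                naturality X Y f := ?_ }) (fun X => ?_)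
  · exact tensorEval_naturality ((BaseChange.ofBase A C).map f) _
  · exact (tensorι_mapRight ((BaseChange.ofBase A C).map f) _).symm
  · refine sum_tensorEval_tensorι ((BaseChange.ofBase A C).obj X) _ _ fun m => ?_
    ext j
    simp [Pi.single_apply]

variable (C) in
/-- The functor which sends `X` to the diagram of the `A^n ⊗ X` over the finite free modules
over `M`. -/
noncomputable def freeDiagramFunctor : C ⥤ FreeOver A M ⥤ C where
  obj X := freeDiagram M ((BaseChange.ofBase A C).obj X)
  map f :=
    { app j := (tensorFunctor C (Fin j.rank → A)).map f
      naturality _ _ g := tensorMapLeft_mapRight ((BaseChange.ofBase A C).map f) g.lin }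
  map_id X := by
    ext j
    exact (tensorFunctor C (Fin j.rank → A)).map_id X
  map_comp f g := by
    ext j
    exact (tensorFunctor C (Fin j.rank → A)).map_comp f g

instance [Module.Flat A M] : HasColimitsOfShape (FreeOver A M) C :=
  HasFilteredColimitsOfSize.HasColimitsOfShape _

variable (C) in
/-- `M ⊗ X` as the colimit of its canonical diagram, naturally in `X`. -/
noncomputable def tensorFunctorIso [Module.Flat A M] :
    freeDiagramFunctor C (A := A) M ⋙ colim ≅ tensorFunctor C (A := A) M :=
  NatIso.ofComponents
    (fun X => (colimit.isColimit _).coconePointUniqueUpToIso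
      (freeCoconeIsColimit M ((BaseChange.ofBase A C).obj X)))
    (fun {X Y} f => by
      refine colimit.hom_ext fun j => ?_
      have h (Z : C) := IsColimit.comp_coconePointUniqueUpToIso_hom (colimit.isColimit _)
        (freeCoconeIsColimit M ((BaseChange.ofBase A C).obj Z)) j
      have h1 : colimit.ι ((freeDiagramFunctor C (A := A) M).obj X) j ≫
          colim.map ((freeDiagramFunctor C (A := A) M).map f) = _ := ι_colimMap _ _
      refine (Category.assoc _ _ _).symm.trans ((congrArg (· ≫ _) h1).trans ?_)
      refine (Category.assoc _ _ _).trans ((congrArg (_ ≫ ·) (h Y)).trans ?_)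
      refine Eq.trans ?_ (Category.assoc _ _ _)
      refine Eq.trans ?_ (congrArg (· ≫ _) (h X)).symm
      exact (tensorMapLeft_mapRight ((BaseChange.ofBase A C).map f) j.map).symm)

variable (C) in
lemma tensorFunctor_preservesFiniteLimits [Module.Flat A M] [AB5OfSize.{w, w} C] :
    PreservesFiniteLimits (tensorFunctor C (A := A) M) := by
  have : PreservesFiniteLimits (freeDiagramFunctor C (A := A) M) :=
    ⟨fun J _ _ => preservesLimitsOfShape_of_evaluation _ _ fun j =>
      tensorFunctor_free_preservesLimitsOfShape C j.rank J⟩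
  have : HasExactColimitsOfShape (FreeOver A M) C := AB5OfSize.ofShape _
  exact preservesFiniteLimits_of_natIso (tensorFunctorIso C (A := A) M)

end Exactness

section FaithfullyFlat

variable {A : Type w} [CommRing A]
  {C : Type u} [Category.{v} C] [Abelian C] [Linear A C] [HasFilteredColimitsOfSize.{w, w} C]
  [AB5OfSize.{w, w} C] {M : Type w} [AddCommGroup M] [Module A M]

/-- A vector of `A^n` with image outside of `I M` for all proper ideals `I` is unimodular. -/
lemma exists_linearForm_eq_one {n : ℕ} (f : (Fin n → A) →ₗ[A] M) (x : Fin n → A)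
    (h : ∀ I : Ideal A, f x ∈ I • (⊤ : Submodule A M) → I = ⊤) :
    ∃ l : (Fin n → A) →ₗ[A] A, l x = 1 := by
  have hx : f x ∈ Ideal.span (Set.range x) • (⊤ : Submodule A M) := by
    have : f x = ∑ i, x i • f (Pi.single i 1) := by
      conv_lhs => rw [← Finset.univ_sum_single x, map_sum]
      refine Finset.sum_congr rfl fun i _ => ?_
      rw [← map_smul, ← Pi.single_smul, smul_eq_mul, mul_one]
    rw [this]
    exact Submodule.sum_mem _ fun i _ =>
      Submodule.smul_mem_smul (Ideal.subset_span ⟨i, rfl⟩) trivial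
  have h1 := (Ideal.eq_top_iff_one _).1 (h _ hx)
  obtain ⟨c, hc⟩ := (Ideal.mem_span_range_iff_exists_fun).1 h1
  refine ⟨∑ i, c i • LinearMap.proj i, ?_⟩
  simpa using hc

/-- If `m ∈ M` lies in no `I M` for `I` a proper ideal and `M` is flat, then `X → M ⊗ X`,
`x ↦ m ⊗ x`, is a monomorphism. -/
lemma mono_tensorι [Module.Flat A M] (m : M)
    (h : ∀ I : Ideal A, m ∈ I • (⊤ : Submodule A M) → I = ⊤) (X : BaseChange A A C) :
    Mono (tensorι X m) := by
  let j₀ : FreeOver A M := FreeOver.point m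
  have : HasColimitsOfShape (Under j₀) C := HasFilteredColimitsOfSize.HasColimitsOfShape _
  have : HasExactColimitsOfShape (Under j₀) C := AB5OfSize.ofShape _
  have : IsConnected (Under j₀) := IsFiltered.isConnected _
  let vec (j : Under j₀) : Fin j.right.rank → A :=
    FreeOver.Hom.lin j.hom (FreeOver.pointGen A)
  have hvec (j : Under j₀) : j.right.map (vec j) = m :=
    (FreeOver.map_lin j.hom _).trans (FreeOver.point_map_gen m)
  let φ : (Functor.const (Under j₀)).obj X.obj ⟶ Under.forget j₀ ⋙ freeDiagram M X :=
    { app j := tensorι X (vec j)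
      naturality i j g := by
        refine (Category.id_comp _).trans (Eq.trans ?_ (tensorι_mapLeft X g.right.lin (vec i)).symm)
        exact congrArg (tensorι X) (LinearMap.congr_fun (congrArg FreeOver.Hom.lin (Under.w g)).symm
          (FreeOver.pointGen A)) }
  have hφ (j : Under j₀) : Mono (φ.app j) := by
    obtain ⟨l, hl⟩ := exists_linearForm_eq_one j.right.map (vec j) fun I hI => h I (hvec j ▸ hI)
    have h1 : tensorι X (vec j) ≫ tensorEval X l = 𝟙 _ := by
      rw [tensorι_eval, hl, X.actHom_one]
    exact (SplitMono.mk _ h1).mono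
  have := NatTrans.mono_of_mono_app φ
  exact colim.map_mono' φ (isColimitConstCocone _ _)
    ((Functor.Final.isColimitWhiskerEquiv (Under.forget j₀) _).symm (freeCoconeIsColimit M X))
    (tensorι X m) fun j => (Category.id_comp _).trans
      (((congrArg (tensorι X) (hvec j)).symm).trans
        (tensorι_mapLeft X j.right.map (vec j)).symm)

lemma eq_top_of_one_mem_smul_top {A' : Type w} [CommRing A'] [Algebra A A']
    [Module.FaithfullyFlat A A'] (I : Ideal A)
    (h : (1 : A') ∈ I • (⊤ : Submodule A A')) : I = ⊤ := by
  refine ((Module.FaithfullyFlat.iff_flat_and_ideal_smul_eq_top A A').1 ‹_›).2 I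
    (eq_top_iff.2 fun x _ => ?_)
  have h1 : LinearMap.mulLeft A x 1 ∈ (I • (⊤ : Submodule A A')).map (LinearMap.mulLeft A x) :=
    Submodule.mem_map_of_mem h
  rw [Submodule.map_smul'', LinearMap.mulLeft_apply, mul_one] at h1
  exact Submodule.smul_mono le_rfl le_top h1

end FaithfullyFlat

/-! ### Comonadicity of the pullback functor -/

section Comonadicity

variable (A A' : Type w) [CommRing A] [CommRing A'] [Algebra A A']
  (C : Type u) [Category.{v} C] [Abelian C] [Linear A C]

/-- The functor which forgets the action. -/
@[simps]
def forgetAction : BaseChange A A' C ⥤ C where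
  obj X := X.obj
  map f := f.hom

instance : (forgetAction A A' C).Faithful where
  map_injective h := BaseChange.hom_ext h

instance : (forgetAction A A' C).ReflectsIsomorphisms where
  reflects {X Y} f hf := by
    have hf' : IsIso f.hom := hf
    refine ⟨⟨inv f.hom, fun b => ?_⟩, BaseChange.hom_ext ?_, BaseChange.hom_ext ?_⟩
    · rw [IsIso.comp_inv_eq, Category.assoc, f.comm, IsIso.inv_hom_id_assoc]
    · exact IsIso.hom_inv_id f.hom
    · exact IsIso.inv_hom_id f.hom

variable {A A' C}

lemma ofBase_semilinear {X : C} {Y : BaseChange A A' C} (f : X ⟶ Y.obj) (a : A) :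
    ((BaseChange.ofBase A C).obj X).actHom a ≫ f = f ≫ Y.actHom (Algebra.ofId A A' a) := by
  have h : Y.actHom (Algebra.ofId A A' a) = a • 𝟙 Y.obj := Y.actHom_algebraMap a
  have h' : ((BaseChange.ofBase A C).obj X).actHom a = a • 𝟙 X :=
    BaseChange.actHom_algebraMap ((BaseChange.ofBase A C).obj X) a
  rw [h, h', Linear.comp_smul, Category.comp_id]
  exact (Linear.smul_comp _ _ _ _ _ _).trans (congrArg _ (Category.id_comp f))

variable [HasFilteredColimitsOfSize.{w, w} C]

variable (A A') in
/-- The unit `X → A' ⊗ X`. -/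
noncomputable def pullbackUnit (X : C) : X ⟶ ((pullback A A' C).obj X).obj :=
  extendUnit (Algebra.ofId A A') ((BaseChange.ofBase A C).obj X)

/-- The morphism `A' ⊗ X → Y` attached to `X → Y`. -/
noncomputable def pullbackLift {X : C} {Y : BaseChange A A' C} (f : X ⟶ Y.obj) :
    (pullback A A' C).obj X ⟶ Y :=
  extendLift (X := (BaseChange.ofBase A C).obj X) (Algebra.ofId A A') f (ofBase_semilinear f)

@[simp]
lemma pullbackUnit_lift {X : C} {Y : BaseChange A A' C} (f : X ⟶ Y.obj) :
    pullbackUnit A A' X ≫ (pullbackLift f).hom = f :=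
  extendUnit_lift (X := (BaseChange.ofBase A C).obj X) _ f _

@[simp]
lemma pullbackUnit_lift_assoc {X : C} {Y : BaseChange A A' C} (f : X ⟶ Y.obj) {Z : C}
    (g : Y.obj ⟶ Z) : pullbackUnit A A' X ≫ (pullbackLift f).hom ≫ g = f ≫ g := by
  rw [← Category.assoc, pullbackUnit_lift]

lemma pullback_hom_ext {X : C} {Y : BaseChange A A' C} {f g : (pullback A A' C).obj X ⟶ Y}
    (h : pullbackUnit A A' X ≫ f.hom = pullbackUnit A A' X ≫ g.hom) : f = g :=
  extend_hom_ext (Algebra.ofId A A') h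

@[simp]
lemma pullbackUnit_map {X Y : C} (f : X ⟶ Y) :
    pullbackUnit A A' X ≫ ((pullback A A' C).map f).hom = f ≫ pullbackUnit A A' Y :=
  extendUnit_map (Algebra.ofId A A') ((BaseChange.ofBase A C).map f)

@[simp]
lemma pullbackUnit_map_assoc {X Y Z : C} (f : X ⟶ Y)
    (g : ((pullback A A' C).obj Y).obj ⟶ Z) :
    pullbackUnit A A' X ≫ ((pullback A A' C).map f).hom ≫ g = f ≫ pullbackUnit A A' Y ≫ g := by
  rw [← Category.assoc, pullbackUnit_map, Category.assoc]

variable (A A' C) in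
/-- The adjunction between pullback and the forgetful functor. -/
noncomputable def pullbackAdj : pullback A A' C ⊣ forgetAction A A' C :=
  Adjunction.mkOfHomEquiv
    { homEquiv X Y :=
        { toFun f := pullbackUnit A A' X ≫ f.hom
          invFun f := pullbackLift f
          left_inv f := pullback_hom_ext (pullbackUnit_lift _)
          right_inv f := pullbackUnit_lift _ }
      homEquiv_naturality_left_symm {X' X Y} f g := pullback_hom_ext (by
        refine (pullbackUnit_lift _).trans ?_
        rw [BaseChange.comp_hom, pullbackUnit_map_assoc]
        exact congrArg (f ≫ ·) (pullbackUnit_lift g).symm)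
      homEquiv_naturality_right f g := (Category.assoc _ _ _).symm }

lemma pullbackAdj_unit (X : C) : (pullbackAdj A A' C).unit.app X = pullbackUnit A A' X := by
  refine (Adjunction.mkOfHomEquiv_unit_app _ _).trans ?_
  exact Category.comp_id _

lemma pullbackAdj_counit (X : BaseChange A A' C) :
    (pullbackAdj A A' C).counit.app X = pullbackLift (𝟙 X.obj) :=
  Adjunction.mkOfHomEquiv_counit_app _ _

lemma compHom_ofId :
    Module.compHom A' (Algebra.ofId A A').toRingHom = (Algebra.toModule : Module A A') :=
  Module.ext (by
    ext a x
    exact (Algebra.smul_def a x).symm)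

lemma extendι_map {B B' : Type w} [CommRing B] [CommRing B'] [Algebra A B] [Algebra A B']
    (g : B →ₐ[A] B') {X Y : BaseChange A B C} (f : X ⟶ Y) (m : B') :
    extendι g X m ≫ (extendMap g f).hom = f.hom ≫ extendι g Y m := by
  have h : (extendUnit g X ≫ (extendObj g X).actHom m) ≫ (extendMap g f).hom =
      f.hom ≫ extendUnit g Y ≫ (extendObj g Y).actHom m := by
    rw [Category.assoc, (extendMap g f).comm, extendUnit_map_assoc]
  exact (congrArg (· ≫ (extendMap g f).hom) (extendUnit_actHom g X m)).symm.trans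
    (h.trans (congrArg (f.hom ≫ ·) (extendUnit_actHom g Y m)))

variable (A A' C) in
/-- The functor underlying the pullback is the tensor product with `A'`. -/
noncomputable def pullbackForgetIso :
    letI : Module A A' := Module.compHom A' (Algebra.ofId A A').toRingHom
    tensorFunctor C (A := A) A' ≅ pullback A A' C ⋙ forgetAction A A' C :=
  letI : Module A A' := Module.compHom A' (Algebra.ofId A A').toRingHom
  NatIso.ofComponents (fun X => Iso.refl _) (fun {X Y} f => by
    refine (Category.comp_id _).trans (Eq.trans ?_ (Category.id_comp _).symm)
    refine tensor_hom_ext _ fun m => ?_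
    refine (tensorι_mapRight _ m).trans (Eq.symm ?_)
    exact extendι_map (Algebra.ofId A A') ((BaseChange.ofBase A C).map f) m)

variable [Module.FaithfullyFlat A A'] [AB5OfSize.{w, w} C]

instance mono_pullbackUnit (X : C) : Mono (pullbackUnit A A' X) := by
  let mod : Module A A' := Module.compHom A' (Algebra.ofId A A').toRingHom
  have e : mod = Algebra.toModule := compHom_ofId
  have : @Module.Flat A A' _ _ mod := by rw [e]; infer_instance
  exact mono_tensorι (1 : A') (fun I hI => eq_top_of_one_mem_smul_top (A' := A') I (e ▸ hI)) _

instance pullback_faithful : (pullback A A' C).Faithful where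
  map_injective {X Y} f g h := by
    rw [← cancel_mono (pullbackUnit A A' Y), ← pullbackUnit_map, h, pullbackUnit_map]

variable (A A' C) in
lemma pullback_forget_preservesFiniteLimits :
    PreservesFiniteLimits (pullback A A' C ⋙ forgetAction A A' C) := by
  let mod : Module A A' := Module.compHom A' (Algebra.ofId A A').toRingHom
  have e : mod = Algebra.toModule := compHom_ofId
  have : @Module.Flat A A' _ _ mod := by rw [e]; infer_instance
  have := tensorFunctor_preservesFiniteLimits C (A := A) A'
  exact preservesFiniteLimits_of_natIso (pullbackForgetIso A A' C)

instance : (pullback A A' C).ReflectsIsomorphisms := by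
  have := reflectsIsomorphisms_of_reflectsMonomorphisms_of_reflectsEpimorphisms
    (pullback A A' C ⋙ forgetAction A A' C)
  refine ⟨fun f hf => ?_⟩
  have : IsIso ((pullback A A' C ⋙ forgetAction A A' C).map f) :=
    inferInstanceAs (IsIso ((forgetAction A A' C).map ((pullback A A' C).map f)))
  exact isIso_of_reflects_iso f (pullback A A' C ⋙ forgetAction A A' C)

lemma pullback_preservesLimit_parallelPair {X Y : C} (f g : X ⟶ Y) :
    PreservesLimit (parallelPair f g) (pullback A A' C) := by
  have := pullback_forget_preservesFiniteLimits A A' C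
  have hm : Mono ((pullback A A' C).map (equalizer.ι f g)).hom :=
    inferInstanceAs (Mono ((pullback A A' C ⋙ forgetAction A A' C).map (equalizer.ι f g)))
  have hl := isLimitForkMapOfIsLimit (pullback A A' C ⋙ forgetAction A A' C) _
    (equalizerIsEqualizer f g)
  refine preservesLimit_of_preserves_limit_cone (equalizerIsEqualizer f g) ?_
  refine (isLimitMapConeForkEquiv (pullback A A' C) (equalizer.condition f g)).symm ?_
  have key (s : Fork ((pullback A A' C).map f) ((pullback A A' C).map g)) :
      ∃ l : s.pt.obj ⟶ ((pullback A A' C).obj (equalizer f g)).obj,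
        l ≫ ((pullback A A' C).map (equalizer.ι f g)).hom = s.ι.hom := by
    obtain ⟨l, hl⟩ := Fork.IsLimit.lift' hl s.ι.hom (congrArg BaseChange.Hom.hom s.condition)
    exact ⟨l, hl⟩
  choose l hl using key
  refine Fork.IsLimit.mk _ (fun s => ⟨l s, fun b => ?_⟩) (fun s => BaseChange.hom_ext (hl s))
    (fun s m hm => BaseChange.hom_ext ?_)
  · rw [← cancel_mono ((pullback A A' C).map (equalizer.ι f g)).hom, Category.assoc, hl, s.ι.comm,
      Category.assoc, BaseChange.Hom.comm, ← Category.assoc, hl]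
  · rw [← cancel_mono ((pullback A A' C).map (equalizer.ι f g)).hom, hl]
    exact congrArg BaseChange.Hom.hom hm

variable (A A' C) in
lemma comparison_isEquivalence : (Comonad.comparison (pullbackAdj A A' C)).IsEquivalence := by
  have : Comonad.HasEqualizerOfIsCosplitPair (pullback A A' C) := ⟨fun _ _ _ => inferInstance⟩
  have : Comonad.PreservesLimitOfIsCosplitPair (pullback A A' C) :=
    ⟨fun f g _ => pullback_preservesLimit_parallelPair f g⟩
  exact (Comonad.comonadicOfHasPreservesFSplitEqualizersOfReflectsIsomorphisms
    (pullbackAdj A A' C)).eqv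

end Comonadicity

/-! ### The action of a tensor product of algebras on a pullback -/

section Box

variable {A A' B : Type w} [CommRing A] [CommRing A'] [Algebra A A'] [CommRing B] [Algebra A B]
  {C : Type u} [Category.{v} C] [Abelian C] [Linear A C] [HasFilteredColimitsOfSize.{w, w} C]

lemma pullbackUnit_act_map {X Y : C} (f : X ⟶ Y) (m : A') :
    pullbackUnit A A' X ≫ ((pullback A A' C).obj X).actHom m ≫ ((pullback A A' C).map f).hom =
      f ≫ pullbackUnit A A' Y ≫ ((pullback A A' C).obj Y).actHom m := by
  rw [((pullback A A' C).map f).comm, pullbackUnit_map_assoc]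

lemma pullback_obj_hom_ext {X Z : C} {f g : ((pullback A A' C).obj X).obj ⟶ Z}
    (h : ∀ m, pullbackUnit A A' X ≫ ((pullback A A' C).obj X).actHom m ≫ f =
      pullbackUnit A A' X ≫ ((pullback A A' C).obj X).actHom m ≫ g) : f = g := by
  refine extendTensor_hom_ext (Algebra.ofId A A') ((BaseChange.ofBase A C).obj X) fun m => ?_
  have e := extendUnit_actHom (Algebra.ofId A A') ((BaseChange.ofBase A C).obj X) m
  refine (congrArg (· ≫ f) e).symm.trans (Eq.trans ?_ (congrArg (· ≫ g) e))
  exact (Category.assoc _ _ _).trans ((h m).trans (Category.assoc _ _ _).symm)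

lemma pullback_map_add {X Y : C} (f g : X ⟶ Y) :
    ((pullback A A' C).map (f + g)).hom =
      ((pullback A A' C).map f).hom + ((pullback A A' C).map g).hom :=
  pullback_obj_hom_ext fun m => by
    rw [Preadditive.comp_add, Preadditive.comp_add, pullbackUnit_act_map, pullbackUnit_act_map,
      pullbackUnit_act_map, Preadditive.add_comp]

lemma pullback_map_smul {X Y : C} (a : A) (f : X ⟶ Y) :
    ((pullback A A' C).map (a • f)).hom = a • ((pullback A A' C).map f).hom :=
  pullback_obj_hom_ext fun m => by
    rw [Linear.comp_smul, Linear.comp_smul, pullbackUnit_act_map, pullbackUnit_act_map,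
      Linear.smul_comp]

variable (A') in
/-- The action of `B` on `A' ⊗ Y` through the right factor. -/
noncomputable def pullbackRightAct (Y : BaseChange A B C) :
    B →ₐ[A] End ((pullback A A' C).obj Y.obj).obj :=
  AlgHom.ofLinearMap
    { toFun b := ((pullback A A' C).map (Y.actHom b)).hom
      map_add' b c := by rw [Y.actHom_add, pullback_map_add]
      map_smul' a b := by
        rw [Algebra.smul_def, Y.actHom_mul, Y.actHom_algebraMap, Linear.comp_smul,
          Category.comp_id, pullback_map_smul]
        rfl }
    (congrArg BaseChange.Hom.hom
      ((congrArg (pullback A A' C).map Y.actHom_one).trans ((pullback A A' C).map_id _)))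
    (fun b c => congrArg BaseChange.Hom.hom
      ((congrArg (pullback A A' C).map (Y.actHom_mul b c)).trans ((pullback A A' C).map_comp _ _)))

lemma pullback_act_commute (Y : BaseChange A B C) (a : A') (b : B) :
    Commute (((pullback A A' C).obj Y.obj).act a) (pullbackRightAct A' Y b) :=
  (((pullback A A' C).map (Y.actHom b)).comm a).symm

variable (A') in
/-- The object `A' ⊗ Y` with the action of `A' ⊗ B`. -/
noncomputable def box (Y : BaseChange A B C) : BaseChange A (A' ⊗[A] B) C where
  obj := ((pullback A A' C).obj Y.obj).obj
  act := Algebra.TensorProduct.lift ((pullback A A' C).obj Y.obj).act (pullbackRightAct A' Y)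
    (pullback_act_commute Y)

lemma box_actHom_left (Y : BaseChange A B C) (a : A') :
    (box A' Y).actHom (a ⊗ₜ 1) = ((pullback A A' C).obj Y.obj).actHom a := by
  have h : Algebra.TensorProduct.lift ((pullback A A' C).obj Y.obj).act (pullbackRightAct A' Y)
      (pullback_act_commute Y) (a ⊗ₜ 1) = ((pullback A A' C).obj Y.obj).act a := by
    rw [Algebra.TensorProduct.lift_tmul, map_one, mul_one]
  exact h

lemma box_actHom_right (Y : BaseChange A B C) (b : B) :
    (box A' Y).actHom (1 ⊗ₜ b) = ((pullback A A' C).map (Y.actHom b)).hom := by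
  have h : Algebra.TensorProduct.lift ((pullback A A' C).obj Y.obj).act (pullbackRightAct A' Y)
      (pullback_act_commute Y) (1 ⊗ₜ b) = pullbackRightAct A' Y b := by
    rw [Algebra.TensorProduct.lift_tmul, map_one, one_mul]
  exact h

/-- Linearity over a tensor product can be tested on the two factors. -/
def homOfTmul {B' : Type w} [CommRing B'] [Algebra A B'] {X Y : BaseChange A (B ⊗[A] B') C}
    (f : X.obj ⟶ Y.obj) (hl : ∀ b : B, X.actHom (b ⊗ₜ 1) ≫ f = f ≫ Y.actHom (b ⊗ₜ 1))
    (hr : ∀ b : B', X.actHom (1 ⊗ₜ b) ≫ f = f ≫ Y.actHom (1 ⊗ₜ b)) : X ⟶ Y where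
  hom := f
  comm x := by
    induction x with
    | zero => rw [X.actHom_zero, Y.actHom_zero, zero_comp, comp_zero]
    | add x y hx hy => rw [X.actHom_add, Y.actHom_add, Preadditive.add_comp, hx, hy,
        Preadditive.comp_add]
    | tmul b c =>
      have e : b ⊗ₜ[A] c = (b ⊗ₜ 1) * (1 ⊗ₜ c) := by
        rw [Algebra.TensorProduct.tmul_mul_tmul, mul_one, one_mul]
      rw [e, X.actHom_mul, Y.actHom_mul, Category.assoc, hl, ← Category.assoc, hr, Category.assoc]

end Box

/-! ### Descent data as coalgebras -/

section Coalgebra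

variable {A A' : Type w} [CommRing A] [CommRing A'] [Algebra A A']
  {C : Type u} [Category.{v} C] [Abelian C] [Linear A C] [HasFilteredColimitsOfSize.{w, w} C]

/-- The canonical morphism `p₂^* X → A' ⊗_A X`. -/
noncomputable def extendToBox (X : BaseChange A A' C) : extendObj (p₂ A A') X ⟶ box A' X :=
  extendLift (Y := box A' X) (p₂ A A') (pullbackUnit A A' X.obj) fun b =>
    (pullbackUnit_map (X.actHom b)).symm.trans (congrArg (_ ≫ ·) (box_actHom_right X b).symm)

lemma extendUnit_toBox (X : BaseChange A A' C) :
    extendUnit (p₂ A A') X ≫ (extendToBox X).hom = pullbackUnit A A' X.obj :=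
  extendUnit_lift (Y := box A' X) _ _ _

/-- The canonical morphism `A' ⊗_A X → p₂^* X`. -/
noncomputable def boxToExtend (X : BaseChange A A' C) : box A' X ⟶ extendObj (p₂ A A') X :=
  let l : (pullback A A' C).obj X.obj ⟶ restrictObj (p₁ A A') (extendObj (p₂ A A') X) :=
    pullbackLift (extendUnit (p₂ A A') X)
  homOfTmul (X := box A' X) (Y := extendObj (p₂ A A') X) l.hom
    (fun a => (congrArg (· ≫ l.hom) (box_actHom_left X a)).trans (l.comm a))
    (fun b => (congrArg (· ≫ l.hom) (box_actHom_right X b)).trans (by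
      let e : restrictObj (p₁ A A') (extendObj (p₂ A A') X) ⟶
          restrictObj (p₁ A A') (extendObj (p₂ A A') X) :=
        ⟨(extendObj (p₂ A A') X).actHom (p₂ A A' b), fun a => by
          change (extendObj (p₂ A A') X).actHom _ ≫ _ = _ ≫ (extendObj (p₂ A A') X).actHom _
          rw [← BaseChange.actHom_mul, ← BaseChange.actHom_mul, mul_comm]⟩
      have h : (pullback A A' C).map (X.actHom b) ≫ l = l ≫ e := by
        refine pullback_hom_ext ?_
        rw [BaseChange.comp_hom, BaseChange.comp_hom, pullbackUnit_map_assoc, pullbackUnit_lift,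
          pullbackUnit_lift_assoc]
        exact extendUnit_semilinear (p₂ A A') X b
      exact congrArg BaseChange.Hom.hom h))

lemma extendToBox_boxToExtend (X : BaseChange A A' C) :
    extendToBox X ≫ boxToExtend X = 𝟙 _ := by
  refine extend_hom_ext (p₂ A A') ?_
  have h : pullbackUnit A A' X.obj ≫ (boxToExtend X).hom = extendUnit (p₂ A A') X :=
    pullbackUnit_lift (Y := restrictObj (p₁ A A') (extendObj (p₂ A A') X)) (extendUnit (p₂ A A') X)
  rw [BaseChange.comp_hom, ← Category.assoc, extendUnit_toBox]
  exact h.trans (Category.comp_id _).symm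

/-- `A' ⊗ f` for a morphism `f`, as a morphism over `A' ⊗ B`. -/
noncomputable def boxMap {X Y : BaseChange A A' C} (f : X ⟶ Y) : box A' X ⟶ box A' Y :=
  homOfTmul (X := box A' X) (Y := box A' Y) ((pullback A A' C).map f.hom).hom
    (fun a => by
      rw [box_actHom_left, box_actHom_left]
      exact ((pullback A A' C).map f.hom).comm a)
    (fun b => by
      rw [box_actHom_right, box_actHom_right]
      exact congrArg BaseChange.Hom.hom (((pullback A A' C).map_comp _ _).symm.trans
        ((congrArg _ (f.comm b)).trans ((pullback A A' C).map_comp _ _))))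

lemma extendToBox_naturality {X Y : BaseChange A A' C} (f : X ⟶ Y) :
    extendToBox X ≫ boxMap f = extendMap (p₂ A A') f ≫ extendToBox Y := by
  refine extend_hom_ext (p₂ A A') ?_
  rw [BaseChange.comp_hom, BaseChange.comp_hom, extendUnit_map_assoc, extendUnit_toBox,
    ← Category.assoc, extendUnit_toBox]
  exact pullbackUnit_map f.hom

/-- The morphism `X → A' ⊗_A X` of `C'` attached to a morphism `p₁^* X → p₂^* X`. -/
noncomputable def coaction {X : BaseChange A A' C}
    (φ : extendObj (p₁ A A') X ⟶ extendObj (p₂ A A') X) : X ⟶ (pullback A A' C).obj X.obj where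
  hom := extendUnit (p₁ A A') X ≫ (φ ≫ extendToBox X).hom
  comm b := by
    have h : X.actHom b ≫ extendUnit (p₁ A A') X ≫ (φ ≫ extendToBox X).hom =
        extendUnit (p₁ A A') X ≫ (φ ≫ extendToBox X).hom ≫ (box A' X).actHom (p₁ A A' b) := by
      rw [← Category.assoc, extendUnit_semilinear, Category.assoc, BaseChange.Hom.comm]
    refine (h.trans ?_).trans (Category.assoc _ _ _).symm
    exact congrArg (fun t => extendUnit (p₁ A A') X ≫ (φ ≫ extendToBox X).hom ≫ t)
      (box_actHom_left X b)

lemma coaction_comp_eq_iff {X Y : BaseChange A A' C}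
    (φ : extendObj (p₁ A A') X ⟶ extendObj (p₂ A A') X)
    (ψ : extendObj (p₁ A A') Y ⟶ extendObj (p₂ A A') Y) (f : X ⟶ Y) :
    coaction φ ≫ (pullback A A' C).map f.hom = f ≫ coaction ψ ↔
      φ ≫ extendMap (p₂ A A') f = extendMap (p₁ A A') f ≫ ψ := by
  have h1 : (coaction φ ≫ (pullback A A' C).map f.hom).hom =
      extendUnit (p₁ A A') X ≫ ((φ ≫ extendMap (p₂ A A') f) ≫ extendToBox Y).hom := by
    rw [Category.assoc, ← extendToBox_naturality]
    exact (Category.assoc _ _ _).trans (congrArg (_ ≫ ·) (Category.assoc _ _ _))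
  have h2 : (f ≫ coaction ψ).hom =
      extendUnit (p₁ A A') X ≫ ((extendMap (p₁ A A') f ≫ ψ) ≫ extendToBox Y).hom := by
    rw [Category.assoc, BaseChange.comp_hom (extendMap _ f), extendUnit_map_assoc]
    rfl
  constructor
  · intro h
    have h3 : (φ ≫ extendMap (p₂ A A') f) ≫ extendToBox Y =
        (extendMap (p₁ A A') f ≫ ψ) ≫ extendToBox Y :=
      extend_hom_ext (p₁ A A') (h1.symm.trans ((congrArg BaseChange.Hom.hom h).trans h2))
    have h4 := congrArg (· ≫ boxToExtend Y) h3
    simpa only [Category.assoc, extendToBox_boxToExtend, Category.comp_id] using h4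
  · intro h
    exact BaseChange.hom_ext (h1.trans (by rw [h, h2]))

end Coalgebra

section Cocycle

variable {A B B' B'' : Type w} [CommRing A] [CommRing B] [Algebra A B] [CommRing B'] [Algebra A B']
  [CommRing B''] [Algebra A B'']
  {C : Type u} [Category.{v} C] [Abelian C] [Linear A C] [HasFilteredColimitsOfSize.{w, w} C]

lemma pullHom_comp {g₁ g₂ : B →ₐ[A] B'} (h : B' →ₐ[A] B'') (k₁ k₂ : B →ₐ[A] B'')
    (e₁ : h.comp g₁ = k₁) (e₂ : h.comp g₂ = k₂) {X Y : BaseChange A B C} {Z : BaseChange A B'' C}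
    (φ : extendObj g₁ X ⟶ extendObj g₂ Y) (f : extendObj k₂ Y ⟶ Z)
    (f' : extendObj g₂ Y ⟶ restrictObj h Z)
    (hf : extendUnit k₂ Y ≫ f.hom = extendUnit g₂ Y ≫ f'.hom) :
    extendUnit k₁ X ≫ (pullHom h k₁ k₂ e₁ e₂ φ).hom ≫ f.hom =
      extendUnit g₁ X ≫ φ.hom ≫ f'.hom := by
  let F := (extendComp g₂ h k₂ e₂ Y).inv ≫ f
  let f'' : extendObj g₂ Y ⟶ restrictObj h Z :=
    ⟨extendUnit h (extendObj g₂ Y) ≫ F.hom, fun b => by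
      rw [← Category.assoc, extendUnit_semilinear, Category.assoc, F.comm, Category.assoc]
      rfl⟩
  have key : f'' = f' := extend_hom_ext g₂ (Eq.trans (by simp [f'', F]) hf)
  have key' : extendUnit h (extendObj g₂ Y) ≫ F.hom = f'.hom := congrArg BaseChange.Hom.hom key
  have h1 : pullHom h k₁ k₂ e₁ e₂ φ ≫ f =
      (extendComp g₁ h k₁ e₁ X).hom ≫ extendMap h φ ≫ F := by
    simp [pullHom, F]
  refine (congrArg (fun t => extendUnit k₁ X ≫ t) (congrArg BaseChange.Hom.hom h1)).trans ?_
  rw [BaseChange.comp_hom, BaseChange.comp_hom, extendUnit_comp_hom_assoc, extendUnit_map_assoc]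
  exact congrArg (fun t => extendUnit g₁ X ≫ φ.hom ≫ t) key'

end Cocycle

section Coassociativity

variable {A A' : Type w} [CommRing A] [CommRing A'] [Algebra A A']
  {C : Type u} [Category.{v} C] [Abelian C] [Linear A C] [HasFilteredColimitsOfSize.{w, w} C]

variable (A A') in
/-- The associativity isomorphism of the triple tensor product. -/
def ringAssoc : Ring₃ A A' →ₐ[A] A' ⊗[A] (A' ⊗[A] A') :=
  (Algebra.TensorProduct.assoc A A A A' A' A').toAlgHom

/-- The object `A' ⊗ A' ⊗ X` with the action of the triple tensor product. -/
noncomputable abbrev doubleBox (X : BaseChange A A' C) : BaseChange A (Ring₃ A A') C :=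
  restrictObj (ringAssoc A A') (box A' (box A' X))

/-- Construction of morphisms to the restriction of `doubleBox X` along a morphism given by a
pair of coordinates. -/
noncomputable def toDoubleBox {X : BaseChange A A' C} (q q' : A' →ₐ[A] Ring₃ A A')
    (f : ((pullback A A' C).obj X.obj).obj ⟶
      ((pullback A A' C).obj ((pullback A A' C).obj X.obj).obj).obj)
    (hl : ∀ a, ((pullback A A' C).obj X.obj).actHom a ≫ f =
      f ≫ (box A' (box A' X)).actHom (ringAssoc A A' (q a)))
    (hr : ∀ a, ((pullback A A' C).map (X.actHom a)).hom ≫ f =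
      f ≫ (box A' (box A' X)).actHom (ringAssoc A A' (q' a))) :
    box A' X ⟶ restrictObj (Algebra.TensorProduct.productMap q q') (doubleBox X) :=
  homOfTmul (X := box A' X)
    (Y := restrictObj (Algebra.TensorProduct.productMap q q') (doubleBox X)) f
    (fun a => by
      refine (congrArg (· ≫ f) (box_actHom_left X a)).trans ((hl a).trans ?_)
      have e : Algebra.TensorProduct.productMap q q' (a ⊗ₜ 1) = q a := by simp
      exact congrArg (fun t => f ≫ (box A' (box A' X)).actHom (ringAssoc A A' t)) e.symm)
    (fun a => by
      refine (congrArg (· ≫ f) (box_actHom_right X a)).trans ((hr a).trans ?_)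
      have e : Algebra.TensorProduct.productMap q q' (1 ⊗ₜ a) = q' a := by simp
      exact congrArg (fun t => f ≫ (box A' (box A' X)).actHom (ringAssoc A A' t)) e.symm)

lemma doubleBox_actHom_left (X : BaseChange A A' C) (a : A') :
    (box A' (box A' X)).actHom (a ⊗ₜ 1) =
      ((pullback A A' C).obj ((pullback A A' C).obj X.obj).obj).actHom a :=
  box_actHom_left (box A' X) a

lemma doubleBox_actHom_middle (X : BaseChange A A' C) (a : A') :
    (box A' (box A' X)).actHom (1 ⊗ₜ (a ⊗ₜ 1)) =
      ((pullback A A' C).map (((pullback A A' C).obj X.obj).actHom a)).hom :=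
  (box_actHom_right (box A' X) _).trans
    (congrArg (fun t => ((pullback A A' C).map t).hom) (box_actHom_left X a))

lemma doubleBox_actHom_right (X : BaseChange A A' C) (a : A') :
    (box A' (box A' X)).actHom (1 ⊗ₜ (1 ⊗ₜ a)) =
      ((pullback A A' C).map ((pullback A A' C).map (X.actHom a)).hom).hom :=
  (box_actHom_right (box A' X) _).trans
    (congrArg (fun t => ((pullback A A' C).map t).hom) (box_actHom_right X a))

lemma pullback_map_hom_comp {X Y Z : C} (f : X ⟶ Y) (g : Y ⟶ Z) :
    ((pullback A A' C).map f).hom ≫ ((pullback A A' C).map g).hom =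
      ((pullback A A' C).map (f ≫ g)).hom :=
  (congrArg BaseChange.Hom.hom ((pullback A A' C).map_comp f g)).symm

/-- `a ⊗ x ↦ a ⊗ 1 ⊗ x`. -/
noncomputable def insertMiddle (X : BaseChange A A' C) :
    box A' X ⟶ restrictObj (q₁₃ A A') (doubleBox X) :=
  toDoubleBox (q₁ A A') (q₃ A A') ((pullback A A' C).map (pullbackUnit A A' X.obj)).hom
    (fun a => (((pullback A A' C).map (pullbackUnit A A' X.obj)).comm a).trans
      (congrArg (_ ≫ ·) (doubleBox_actHom_left X a).symm))
    (fun a => by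
      refine Eq.trans ?_ (congrArg (_ ≫ ·) (doubleBox_actHom_right X a).symm)
      rw [pullback_map_hom_comp, pullback_map_hom_comp, pullbackUnit_map])

/-- `a ⊗ x ↦ 1 ⊗ a ⊗ x`. -/
noncomputable def insertLeft (X : BaseChange A A' C) :
    box A' X ⟶ restrictObj (q₂₃ A A') (doubleBox X) :=
  toDoubleBox (q₂ A A') (q₃ A A') (pullbackUnit A A' ((pullback A A' C).obj X.obj).obj)
    (fun a => (pullbackUnit_map _).symm.trans
      (congrArg (_ ≫ ·) (doubleBox_actHom_middle X a).symm))
    (fun a => (pullbackUnit_map _).symm.trans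
      (congrArg (_ ≫ ·) (doubleBox_actHom_right X a).symm))

/-- `a ⊗ x ↦ a ⊗ f x` for `f : X → A' ⊗ X`. -/
noncomputable def applyRight {X : BaseChange A A' C} (f : X ⟶ (pullback A A' C).obj X.obj) :
    box A' X ⟶ restrictObj (q₁₂ A A') (doubleBox X) :=
  toDoubleBox (q₁ A A') (q₂ A A') ((pullback A A' C).map f.hom).hom
    (fun a => (((pullback A A' C).map f.hom).comm a).trans
      (congrArg (_ ≫ ·) (doubleBox_actHom_left X a).symm))
    (fun a => by
      refine Eq.trans ?_ (congrArg (_ ≫ ·) (doubleBox_actHom_middle X a).symm)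
      rw [pullback_map_hom_comp, pullback_map_hom_comp, f.comm])

/-- The canonical morphism from the pullback along the third projection to `A' ⊗ A' ⊗ X`. -/
noncomputable def extendToDoubleBox (X : BaseChange A A' C) :
    extendObj (q₃ A A') X ⟶ doubleBox X :=
  extendLift (Y := doubleBox X) (q₃ A A')
    (pullbackUnit A A' X.obj ≫ pullbackUnit A A' ((pullback A A' C).obj X.obj).obj) fun a => by
      refine Eq.trans ?_ (congrArg (_ ≫ ·) (doubleBox_actHom_right X a).symm)
      have h : X.actHom a ≫ pullbackUnit A A' X.obj ≫ pullbackUnit A A' _ =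
          (pullbackUnit A A' X.obj ≫ pullbackUnit A A' _) ≫
            ((pullback A A' C).map ((pullback A A' C).map (X.actHom a)).hom).hom := by
        rw [Category.assoc, pullbackUnit_map, pullbackUnit_map_assoc]
      exact h

lemma extendUnit_toDoubleBox (X : BaseChange A A' C) :
    extendUnit (q₃ A A') X ≫ (extendToDoubleBox X).hom =
      pullbackUnit A A' X.obj ≫ pullbackUnit A A' ((pullback A A' C).obj X.obj).obj :=
  extendUnit_lift (Y := doubleBox X) _ _ _

lemma extendUnit_toBox_comp {X : BaseChange A A' C} (q : Ring₂ A A' →ₐ[A] Ring₃ A A')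
    (f : box A' X ⟶ restrictObj q (doubleBox X)) :
    extendUnit (p₂ A A') X ≫ (extendToBox X ≫ f).hom = pullbackUnit A A' X.obj ≫ f.hom :=
  (Category.assoc _ _ _).symm.trans (congrArg (· ≫ f.hom) (extendUnit_toBox X))

/-- The cocycle condition implies the coassociativity of the coaction. -/
lemma coaction_coassoc {X : BaseChange A A' C}
    (φ : extendObj (p₁ A A') X ⟶ extendObj (p₂ A A') X)
    (hφ : pullHom (q₁₂ A A') (q₁ A A') (q₂ A A') (Algebra.TensorProduct.productMap_left _ _)
        (Algebra.TensorProduct.productMap_right _ _) φ ≫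
      pullHom (q₂₃ A A') (q₂ A A') (q₃ A A') (Algebra.TensorProduct.productMap_left _ _)
        (Algebra.TensorProduct.productMap_right _ _) φ =
      pullHom (q₁₃ A A') (q₁ A A') (q₃ A A') (Algebra.TensorProduct.productMap_left _ _)
        (Algebra.TensorProduct.productMap_right _ _) φ) :
    coaction φ ≫ (pullback A A' C).map (pullbackUnit A A' X.obj) =
      coaction φ ≫ (pullback A A' C).map (coaction φ).hom := by
  have assoc (q : Ring₂ A A' →ₐ[A] Ring₃ A A') (f : box A' X ⟶ restrictObj q (doubleBox X)) :
      extendUnit (p₁ A A') X ≫ φ.hom ≫ (extendToBox X ≫ f).hom = (coaction φ).hom ≫ f.hom := by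
    refine Eq.trans ?_ (Category.assoc _ _ _).symm
    exact congrArg (_ ≫ ·) (Category.assoc _ _ _).symm
  have h₁₃ := (pullHom_comp (q₁₃ A A') (q₁ A A') (q₃ A A')
    (Algebra.TensorProduct.productMap_left _ _) (Algebra.TensorProduct.productMap_right _ _) φ
    (extendToDoubleBox X) (extendToBox X ≫ insertMiddle X) (by
      refine (extendUnit_toDoubleBox X).trans (Eq.trans ?_ (extendUnit_toBox_comp _ _).symm)
      exact (pullbackUnit_map (pullbackUnit A A' X.obj)).symm)).trans (assoc _ _)
  have h₂₃ := (pullHom_comp (q₂₃ A A') (q₂ A A') (q₃ A A')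
    (Algebra.TensorProduct.productMap_left _ _) (Algebra.TensorProduct.productMap_right _ _) φ
    (extendToDoubleBox X) (extendToBox X ≫ insertLeft X)
      ((extendUnit_toDoubleBox X).trans (extendUnit_toBox_comp _ (insertLeft X)).symm)).trans
    (assoc _ _)
  have h₁₂ := (pullHom_comp (q₁₂ A A') (q₁ A A') (q₂ A A')
    (Algebra.TensorProduct.productMap_left _ _) (Algebra.TensorProduct.productMap_right _ _) φ
    (pullHom (q₂₃ A A') (q₂ A A') (q₃ A A') (Algebra.TensorProduct.productMap_left _ _)
        (Algebra.TensorProduct.productMap_right _ _) φ ≫ extendToDoubleBox X)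
    (extendToBox X ≫ applyRight (coaction φ)) (by
      refine h₂₃.trans (Eq.trans ?_ (extendUnit_toBox_comp _ _).symm)
      exact (pullbackUnit_map (coaction φ).hom).symm)).trans (assoc _ _)
  refine BaseChange.hom_ext (h₁₃.symm.trans (Eq.trans ?_ h₁₂))
  rw [← hφ, BaseChange.comp_hom, BaseChange.comp_hom, Category.assoc]

lemma pullbackUnit_counit (X : BaseChange A A' C) :
    pullbackUnit A A' X.obj ≫ (pullbackLift (𝟙 X.obj) : (pullback A A' C).obj X.obj ⟶ X).hom =
      𝟙 X.obj :=
  pullbackUnit_lift _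

/-- The coaction attached to an isomorphism is counital if it is coassociative. -/
lemma coaction_counit {X : BaseChange A A' C}
    (φ : extendObj (p₁ A A') X ≅ extendObj (p₂ A A') X)
    (h : coaction φ.hom ≫ (pullback A A' C).map (pullbackUnit A A' X.obj) =
      coaction φ.hom ≫ (pullback A A' C).map (coaction φ.hom).hom) :
    coaction φ.hom ≫ pullbackLift (𝟙 X.obj) = 𝟙 X := by
  let ε : (pullback A A' C).obj X.obj ⟶ X := pullbackLift (𝟙 X.obj)
  let α : X ⟶ X := coaction φ.hom ≫ ε
  change α = 𝟙 X
  have h1 : coaction φ.hom ≫ (pullback A A' C).map α.hom = coaction φ.hom := by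
    have h2 := congrArg (· ≫ (pullback A A' C).map ε.hom) h
    simp only [Category.assoc, ← Functor.map_comp] at h2
    rw [pullbackUnit_counit X, (pullback A A' C).map_id, Category.comp_id] at h2
    exact h2.symm
  have h3 : φ.hom ≫ extendToBox X ≫ boxMap α = φ.hom ≫ extendToBox X := by
    refine extend_hom_ext (p₁ A A') (Eq.trans ?_ (congrArg BaseChange.Hom.hom h1))
    refine (congrArg (fun t => extendUnit (p₁ A A') X ≫ t)
      (Category.assoc φ.hom.hom (extendToBox X).hom (boxMap α).hom)).symm.trans ?_
    exact (Category.assoc _ _ _).symm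
  have h4 : extendToBox X ≫ boxMap α = extendToBox X := (cancel_epi φ.hom).1 h3
  have h5 : pullbackUnit A A' X.obj ≫ (boxMap α).hom = pullbackUnit A A' X.obj := by
    refine (congrArg (· ≫ (boxMap α).hom) (extendUnit_toBox X)).symm.trans ?_
    refine (Category.assoc _ _ _).trans (Eq.trans ?_ (extendUnit_toBox X))
    exact congrArg (fun t => extendUnit (p₂ A A') X ≫ t) (congrArg BaseChange.Hom.hom h4)
  have h6 : α.hom ≫ pullbackUnit A A' X.obj = pullbackUnit A A' X.obj :=
    (pullbackUnit_map α.hom).symm.trans h5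
  have h7 := congrArg (· ≫ ε.hom) h6
  simp only [Category.assoc] at h7
  rw [pullbackUnit_counit X, Category.comp_id] at h7
  exact BaseChange.hom_ext h7

end Coassociativity

section Functor

variable (A A' : Type w) [CommRing A] [CommRing A'] [Algebra A A']
  (C : Type u) [Category.{v} C] [Abelian C] [Linear A C] [HasFilteredColimitsOfSize.{w, w} C]

/-- The functor from descent data to coalgebras over the comonad of the pullback. -/
noncomputable def descentToCoalgebra :
    DescentData A A' C ⥤ (pullbackAdj A A' C).toComonad.Coalgebra where
  obj X :=
    { A := X.obj
      a := coaction X.iso.hom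
      counit := (congrArg (coaction X.iso.hom ≫ ·) (pullbackAdj_counit X.obj)).trans
        (coaction_counit X.iso (coaction_coassoc _ X.cocycle))
      coassoc := (congrArg (fun t => coaction X.iso.hom ≫ (pullback A A' C).map t)
        (pullbackAdj_unit X.obj.obj)).trans (coaction_coassoc _ X.cocycle) }
  map {X Y} f :=
    { f := f.hom
      h := (coaction_comp_eq_iff X.iso.hom Y.iso.hom f.hom).2 f.comm }
  map_id _ := rfl
  map_comp _ _ := rfl

instance : (descentToCoalgebra A A' C).Faithful where
  map_injective h := DescentData.hom_ext (congrArg Comonad.Coalgebra.Hom.f h)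

instance : (descentToCoalgebra A A' C).Full where
  map_surjective {X Y} f :=
    ⟨⟨f.f, (coaction_comp_eq_iff X.iso.hom Y.iso.hom f.f).1 f.h⟩, rfl⟩

variable {C} in
lemma coaction_pullbackIso (X : C) :
    coaction (pullbackIso A A' C X).hom = (pullback A A' C).map (pullbackUnit A A' X) := by
  refine pullback_hom_ext (Eq.trans ?_ (pullbackUnit_map _).symm)
  let Y := (BaseChange.ofBase A C).obj X
  have h : extendUnit (Algebra.ofId A A') Y ≫ extendUnit (p₁ A A') (extendObj _ Y) ≫
      (pullbackIso A A' C X).hom.hom =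
      extendUnit (Algebra.ofId A A') Y ≫ extendUnit (p₂ A A') (extendObj _ Y) := by
    refine (extendUnit_comp_inv_assoc (Algebra.ofId A A') (p₁ A A') _
      (Subsingleton.elim _ _) Y _).trans ?_
    exact extendUnit_comp_hom (Algebra.ofId A A') (p₂ A A') _ (Subsingleton.elim _ _) Y
  have h' := congrArg (· ≫ (extendToBox ((pullback A A' C).obj X)).hom) h
  refine Eq.trans ?_ (h'.trans ?_)
  · exact ((Category.assoc _ _ _).trans (congrArg (_ ≫ ·) (Category.assoc _ _ _))).symm
  · exact (Category.assoc _ _ _).trans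
      (congrArg (_ ≫ ·) (extendUnit_toBox ((pullback A A' C).obj X)))

/-- The canonical descent datum corresponds to the canonical coalgebra structure. -/
noncomputable def toDescentDataCompIso :
    toDescentData A A' C ⋙ descentToCoalgebra A A' C ≅ Comonad.comparison (pullbackAdj A A' C) :=
  NatIso.ofComponents
    (fun X => Comonad.Coalgebra.isoMk (Iso.refl _) (by
      refine (congrArg (_ ≫ ·) ((pullbackAdj A A' C).toComonad.map_id _)).trans
        ((Category.comp_id _).trans (Eq.trans ?_ (Category.id_comp _).symm))
      exact (coaction_pullbackIso A A' X).trans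
        (congrArg (pullback A A' C).map (pullbackAdj_unit X).symm)))
    (fun f => Comonad.Coalgebra.Hom.ext
      ((Category.comp_id _).trans (Category.id_comp _).symm))

end Functor

end LinearDescent

theorem proposition8 (A A' : Type w) [CommRing A] [CommRing A'] [Algebra A A']
    [Module.FaithfullyFlat A A']
    (C : Type u) [Category.{v} C] [Abelian C] [Linear A C]
    [HasFilteredColimitsOfSize.{w, w} C] [AB5OfSize.{w, w} C] :
    (LinearDescent.toDescentData A A' C).IsEquivalence := by
  have := LinearDescent.comparison_isEquivalence A A' C
  let e := LinearDescent.toDescentDataCompIso A A' C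
  have : (LinearDescent.toDescentData A A' C ⋙
      LinearDescent.descentToCoalgebra A A' C).IsEquivalence :=
    Functor.isEquivalence_of_iso e.symm
  have : (LinearDescent.descentToCoalgebra A A' C).EssSurj :=
    ⟨fun Y => ⟨_, ⟨(LinearDescent.toDescentData A A' C ⋙
      LinearDescent.descentToCoalgebra A A' C).objObjPreimageIso Y⟩⟩⟩
  have : (LinearDescent.descentToCoalgebra A A' C).IsEquivalence := {}
  exact Functor.isEquivalence_of_comp_right _ (LinearDescent.descentToCoalgebra A A' C)
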